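/- **Setting.** The Earth is the sphere of radius $R_\oplus>0$ centred at the origin of $\mathbb R^3$. The typical device is at $\mathbf u_0=(0,0,R_\oplus)$. There are $K$ tiers of satellites; tier $k$ has $N_k$ satellites on the sphere of radius $R_k=R_\oplus+a_k$, $a_k>0$. Tier $m$ is legitimate, and the satellites $j=1,\dots,N_k$ of the tiers $k\ne m$ are the eavesdroppers. Fix the half beamwidth $\theta_{\rm beam}>0$, device density $\lambda_u>0$, and constants $P_t,G,c,f,\sigma^2>0$, $\gamma\in[0,1]$, $m_1\in\{1,2,\dots\}$, $m_2>0$. Put $\theta_{k,\max}=\arcsin(\tfrac{R_k}{R_\oplus}\sin\theta_{\rm beam})-\theta_{\rm beam}$ if $\theta_{\rm beam}<\arcsin(R_\oplus/R_k)$, and $\theta_{k,\max}=\arccos(R_\oplus/R_k)$ otherwise. Over a link of length $d$ with fading power gain $h$ the received power is $P_{\rm rec}=P_tG\left(\frac{c}{4\pi f d}\right)^2h$. Each eavesdropper $(k,j)$ is uniformly distributed on its sphere. The link to it from the typical device has a fading gain $h_{kj}$ of some law $\nu$. The interfering devices form a homogeneous Poisson point process of density $\lambda_u$ on the Earth's surface,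 and their fading gains to the eavesdropper are i.i.d. $\mathrm{Gamma}(m_1,m_2)$ (shape, scale). For each eavesdropper its position, $h_{kj}$, the Poisson process and the interferers' gains are mutually independent. A device is covered by a satellite of tier $k$ when their central angle is less than $\theta_{k,\max}$. Let $I_{kj}$ be the total power received at $(k,j)$ from the interfering devices it covers. With $P_{kj}$ the power received from the typical device, $$\mathrm{SINR}_{kj}=\frac{\gamma P_{kj}}{(1-\gamma)P_{kj}+I_{kj}+\sigma^2}$$ if $(k,j)$ covers the typical device, and $\mathrm{SINR}_{kj}=0$ otherwise. For a threshold $\beta_{\rm ES}>0$ with $\beta_{\rm ES}(1-\gamma)<\gamma$, let $$\mathcal P_{\rm out}=\mathbb P\Big[\max_{k\neq m}\max_{1\le j\le N_k}\mathrm{SINR}_{kj}<\beta_{\rm ES}\Big].$$ With $d_k(\theta)=\sqrt{R_\oplus^2+R_k^2-2R_\oplus R_k\cos\theta}$, put $$s_k(\theta)=\frac{(m_1!)^{-1/m_1}}{m_2}\,\frac{\beta_{\rm ES}}{[\gamma-\beta_{\rm ES}(1-\gamma)]P_tG}\Big(\frac{4\pi f d_k(\theta)}{c}\Big)^2,$$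 $$\mathcal L_k(s)=\exp\Big(-\lambda_u\int_0^{2\pi}\!\!\int_0^{\theta_{k,\max}}\Big[1-\Big(1+m_2sP_tG\Big(\frac{c}{4\pi f d_k(\theta)}\Big)^2\Big)^{-m_1}\Big]R_\oplus^2\sin\theta\,d\theta\,d\varphi\Big),$$ $$B_k=\sum_{q=0}^{m_1}\binom{m_1}{q}(-1)^q\int_0^{\theta_{k,\max}}e^{-q s_k(\theta)\sigma^2}\,\mathcal L_k(q s_k(\theta))\,\frac{\sin\theta}{2}\,d\theta+\frac{1+\cos\theta_{k,\max}}{2}.$$ **Theorem 1 (Secrecy Outage Probability).** 1. Suppose the law $\nu$ of the gains $h_{kj}$ has the distribution function $F(x)=\big[1-\exp\big(-\tfrac{(m_1!)^{-1/m_1}}{m_2}x\big)\big]^{m_1}$, $x\ge 0$, which is used to approximate that of $\mathrm{Gamma}(m_1,m_2)$. Then every eavesdropper of tier $k$ satisfies $\mathbb P[\mathrm{SINR}_{kj}<\beta_{\rm ES}]=B_k$, whatever the dependence between different eavesdroppers (in particular if all of them receive interference from one and the same Poisson process). If moreover the eavesdroppers are treated as mutually independent (the families consisting of the position, fading gains and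 interfering devices of each of them are independent), then $$\mathcal P_{\rm out}=\prod_{k\neq m}B_k^{N_k}.$$ 2. Suppose instead that $\nu$ is the law $\mathrm{Gamma}(m_1,m_2)$ itself. Then $\mathbb P[\mathrm{SINR}_{kj}<\beta_{\rm ES}]\ge B_k$ for every eavesdropper, whatever the dependence between different ones, and $\mathcal P_{\rm out}\ge\prod_{k\ne m}B_k^{N_k}$ if the eavesdroppers are mutually independent. For $m_1=1$ equality holds in both. -/

import Mathlib

open MeasureTheory ProbabilityTheory
open scoped ENNReal NNReal Nat

noncomputable section

/-- Euclidean three-space; the centre of the Earth is the origin. -/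
abbrev E3 : Type := EuclideanSpace ℝ (Fin 3)

/-! ### Surface measure, uniform points and Poisson processes on a sphere -/

/-- Surface area measure (total mass `4 π R ^ 2`) of the sphere of radius `R` centred at the origin,
regarded as a measure on the whole space. -/
def sphereArea (R : ℝ) : Measure E3 :=
  ENNReal.ofReal (R ^ 2) •
    ((volume : Measure E3).toSphere.map (fun z : Metric.sphere (0 : E3) 1 => R • (z : E3)))

/-- The uniform probability distribution on the sphere of radius `R` centred at the origin. -/
def uniformSphere (R : ℝ) : Measure E3 :=
  (sphereArea R Set.univ)⁻¹ • sphereArea R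

open Classical in
/-- The number of points of the finite random configuration `u 0, …, u (n - 1)` lying in `B`. -/
def pointCount {Ω E : Type*} (n : Ω → ℕ) (u : ℕ → Ω → E) (B : Set E) (ω : Ω) : ℕ :=
  ((Finset.range (n ω)).filter (fun i => u i ω ∈ B)).card

/-- The random points `u 0, …, u (n - 1)` (a random number `n` of them) form a Poisson point
process with finite intensity measure `Λ`: the number of points in a measurable set `B` is
Poisson distributed with mean `Λ B`, and the numbers of points in disjoint sets are independent. -/
structure IsPoissonProcess {Ω E : Type*} [MeasurableSpace Ω] [MeasurableSpace E]
    (P : Measure Ω) (Λ : Measure E) (n : Ω → ℕ) (u : ℕ → Ω → E) : Prop where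
  finite_intensity : Λ Set.univ < ∞
  measurable_count : Measurable n
  measurable_point : ∀ i, Measurable (u i)
  poisson_law : ∀ B : Set E, MeasurableSet B →
    P.map (pointCount n u B) = poissonMeasure (Λ B).toNNReal
  indep_disjoint : ∀ (l : ℕ) (B : Fin l → Set E), (∀ i, MeasurableSet (B i)) →
    (∀ i j, i ≠ j → Disjoint (B i) (B j)) → iIndepFun (fun i => pointCount n u (B i)) P

/-! ### The deterministic part of the system -/

/-- Parameters of an uplink system with `K` tiers of satellites. -/
structure Uplink (K : ℕ) where
  /-- Earth radius -/
  RE : ℝ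
  /-- altitude of each tier -/
  alt : Fin K → ℝ
  /-- number of satellites of each tier -/
  num : Fin K → ℕ
  /-- the legitimate tier; satellites of all the other tiers are eavesdroppers -/
  legit : Fin K
  /-- half beamwidth angle of the satellites -/
  beam : ℝ
  /-- density of IoT devices per unit of area on the Earth's surface -/
  dens : ℝ
  /-- transmit power -/
  Pt : ℝ
  /-- product of the antenna gains -/
  G : ℝ
  /-- speed of light -/
  c : ℝ
  /-- carrier frequency -/
  f : ℝ
  /-- noise power -/
  noise : ℝ
  /-- information-bearing ratio: the fraction `1 - γ` of the power is artificial noise -/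
  γ : ℝ
  /-- shape of the Gamma fading -/
  m₁ : ℕ
  /-- scale of the Gamma fading -/
  m₂ : ℝ
  RE_pos : 0 < RE
  alt_pos : ∀ k, 0 < alt k
  beam_pos : 0 < beam
  dens_pos : 0 < dens
  Pt_pos : 0 < Pt
  G_pos : 0 < G
  c_pos : 0 < c
  f_pos : 0 < f
  noise_pos : 0 < noise
  γ_nonneg : 0 ≤ γ
  γ_le_one : γ ≤ 1
  m₁_pos : 1 ≤ m₁
  m₂_pos : 0 < m₂

namespace Uplink

variable {K : ℕ} (S : Uplink K)

/-- Radius of the sphere carrying the satellites of tier `k`. -/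
def R (k : Fin K) : ℝ := S.alt k + S.RE

/-- The largest central angle at which a device is within the beam and the line of sight of a
satellite of tier `k`. -/
def thetaMax (k : Fin K) : ℝ :=
  if S.beam < Real.arcsin (S.RE / S.R k) then
    Real.arcsin (S.R k / S.RE * Real.sin S.beam) - S.beam
  else Real.arccos (S.RE / S.R k)

/-- Distance between a device and a satellite of tier `k` whose central angle is `θ`. -/
def distAt (k : Fin K) (θ : ℝ) : ℝ :=
  √(S.RE ^ 2 + S.R k ^ 2 - 2 * S.RE * S.R k * Real.cos θ)

/-- Power received over a link of length `d` whose small-scale fading power gain is `h`. -/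
def recPower (d h : ℝ) : ℝ :=
  S.Pt * (S.c / (4 * Real.pi * S.f * d)) ^ 2 * S.G * h

/-- The position `(0, 0, RE)` of the typical device. -/
def typical : E3 := !₂[0, 0, S.RE]

/-- The law of the Gamma fading, with shape `m₁` and scale `m₂`. -/
def gammaFading : Measure ℝ := gammaMeasure S.m₁ (1 / S.m₂)

/-- The approximation `[1 - exp(-(m₁!)^(-1/m₁) x / m₂)]^m₁` of the distribution function of the
Gamma fading. -/
def approxCDF (x : ℝ) : ℝ :=
  (1 - Real.exp (-(((S.m₁)! : ℝ) ^ (-(1 / (S.m₁ : ℝ))) / S.m₂ * x))) ^ S.m₁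

/-- The Laplace transform of the interference at a satellite of tier `k`, in integral form. -/
def laplaceInterference (k : Fin K) (s : ℝ) : ℝ :=
  Real.exp (-S.dens * ∫ _φ in (0 : ℝ)..(2 * Real.pi), ∫ θ in (0 : ℝ)..(S.thetaMax k),
    (1 - (1 + S.m₂ * s * S.Pt * S.G *
        (S.c / (4 * Real.pi * S.f * S.distAt k θ)) ^ 2) ^ (-(S.m₁ : ℤ))) *
      S.RE ^ 2 * Real.sin θ)

/-- The quantity `s_ES`, at central angle `θ`, for the threshold `β`. -/
def sES (β : ℝ) (k : Fin K) (θ : ℝ) : ℝ :=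
  ((S.m₁)! : ℝ) ^ (-(1 / (S.m₁ : ℝ))) / S.m₂ *
    (β / ((S.γ - β * (1 - S.γ)) * S.Pt * S.G)) *
    (4 * Real.pi * S.f * S.distAt k θ / S.c) ^ 2

/-- The contribution of one satellite of tier `k` to the secrecy outage formula. -/
def tierFactor (β : ℝ) (k : Fin K) : ℝ :=
  (∑ q ∈ Finset.range (S.m₁ + 1), ((S.m₁.choose q : ℕ) : ℝ) * (-1) ^ q *
    ∫ θ in (0 : ℝ)..(S.thetaMax k),
      Real.exp (-(q * S.sES β k θ * S.noise)) *
        S.laplaceInterference k (q * S.sES β k θ) * (Real.sin θ / 2)) +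
  (1 + Real.cos (S.thetaMax k)) / 2

/-- The closed form of the secrecy outage probability. -/
def outageFormula (β : ℝ) : ℝ :=
  ∏ k ∈ Finset.univ.erase S.legit, S.tierFactor β k ^ S.num k

/-- Labels of the eavesdroppers: pairs of a tier other than the legitimate one and a satellite of
that tier. -/
abbrev Eve : Type := (k : {k : Fin K // k ≠ S.legit}) × Fin (S.num k)

/-- The tier of an eavesdropper. -/
abbrev tier (e : S.Eve) : Fin K := e.1

end Uplink

/-! ### The random part of the system -/

/-- The random quantities seen by one eavesdropping satellite. The interfering devices are
`dev 0, …, dev (n - 1)`. -/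
structure EveData (Ω : Type*) where
  /-- position of the satellite -/
  pos : Ω → E3
  /-- fading power gain of the link from the typical device -/
  gain : Ω → ℝ
  /-- number of interfering devices -/
  n : Ω → ℕ
  /-- positions of the interfering devices -/
  dev : ℕ → Ω → E3
  /-- fading power gains of the links from the interfering devices -/
  devGain : ℕ → Ω → ℝ

namespace EveData

variable {Ω : Type*} {K : ℕ}

/-- All the random quantities of one eavesdropper, bundled in one random variable. -/
def all (D : EveData Ω) (ω : Ω) : E3 × ℝ × (ℕ × (ℕ → E3)) × (ℕ → ℝ) :=
  (D.pos ω, D.gain ω, (D.n ω, fun i => D.dev i ω), fun i => D.devGain i ω)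

open Classical in
/-- Interference power at an eavesdropper of tier `k`: the total power received from the interfering
devices within its coverage area. -/
def interference (S : Uplink K) (k : Fin K) (D : EveData Ω) (ω : Ω) : ℝ :=
  ∑ i ∈ Finset.range (D.n ω),
    if InnerProductGeometry.angle (D.pos ω) (D.dev i ω) < S.thetaMax k then
      S.recPower (dist (D.pos ω) (D.dev i ω)) (D.devGain i ω)
    else 0

open Classical in
/-- SINR of the eavesdropping link to a satellite of tier `k`; it is `0` when the typical device is
outside the coverage area of the satellite, which then receives no signal. -/
def sinr (S : Uplink K) (k : Fin K) (D : EveData Ω) (ω : Ω) : ℝ :=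
  if InnerProductGeometry.angle (D.pos ω) S.typical < S.thetaMax k then
    S.γ * S.recPower (dist (D.pos ω) S.typical) (D.gain ω) /
      ((1 - S.γ) * S.recPower (dist (D.pos ω) S.typical) (D.gain ω) +
        D.interference S k ω + S.noise)
  else 0

/-- The law of what a single eavesdropper of tier `k` sees, when the fading power gain of the link
from the typical device has law `ν`: the satellite is uniform on its sphere, the interfering devices
are a homogeneous Poisson process on the Earth's surface, their fading power gains are i.i.d. Gamma,
and all these quantities are mutually independent. Nothing is said about different eavesdroppers,
which may for instance see the same Poisson process of devices. -/
structure HasModelLaw [MeasurableSpace Ω] (D : EveData Ω) (S : Uplink K) (k : Fin K)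
    (ν : Measure ℝ) (P : Measure Ω) : Prop where
  measurable_pos : Measurable D.pos
  measurable_gain : Measurable D.gain
  measurable_devGain : ∀ i, Measurable (D.devGain i)
  pos_law : P.map D.pos = uniformSphere (S.R k)
  gain_law : P.map D.gain = ν
  devices : IsPoissonProcess P (ENNReal.ofReal S.dens • sphereArea S.RE) D.n D.dev
  devGain_law : ∀ i, P.map (D.devGain i) = S.gammaFading
  devGain_indep : iIndepFun D.devGain P
  indep_pos : IndepFun D.pos (fun ω => (D.all ω).2) P
  indep_gain : IndepFun D.gain (fun ω => (D.all ω).2.2) P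
  indep_devices : IndepFun (fun ω => (D.all ω).2.2.1) (fun ω => (D.all ω).2.2.2) P

end EveData

namespace Uplink

variable {Ω : Type*} {K : ℕ}

/-- The largest SINR over all eavesdroppers (`⊥` if there are none). -/
def maxSINR (S : Uplink K) (D : S.Eve → EveData Ω) (ω : Ω) : EReal :=
  Finset.univ.sup (fun e : S.Eve => (((D e).sinr S (S.tier e) ω : ℝ) : EReal))

/-- The secrecy outage probability: the probability that the largest SINR over all eavesdroppers is
below the threshold `β`. -/
def outageProb [MeasurableSpace Ω] (S : Uplink K) (P : Measure Ω) (D : S.Eve → EveData Ω)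
    (β : ℝ) : ℝ :=
  P.real {ω | S.maxSINR D ω < (β : EReal)}

/-- The eavesdroppers are mutually independent: so are the families of all the random quantities
seen by each of them (positions, fading gains, interfering devices). -/
def EavesdroppersIndep [MeasurableSpace Ω] (S : Uplink K) (P : Measure Ω)
    (D : S.Eve → EveData Ω) : Prop :=
  iIndepFun (fun e => (D e).all) P

end Uplink

end

/-!
Given the position of an eavesdropper and its interferers, its SINR is below `β` exactly when the
gain of the typical device lies below a threshold which is affine in the interference. The
conditional outage probability is thus the distribution function `F` of the gain at this threshold,
and the outage probability is its mean.

For the approximation `F(x) = (1 - exp (-a x)) ^ m₁`, the binomial theorem turns this mean into a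
combination of Laplace transforms of the interference. They are computed from the generating
functional of the Poisson process and the Laplace transform of the Gamma law, and the remaining
integrals over spheres reduce to the central angle, which has density `sin θ / 2` by Archimedes'
hat-box theorem.

For the Gamma law, Alzer's inequality says that the approximation lies below the true distribution
function. The difference of the two vanishes at `0` and at infinity, and its derivative is first
positive and then negative, because `((1 - exp (-y)) / y) ^ (1 / y)` is monotone in `y` by Jensen's
inequality.
-/

noncomputable section

section Independence

variable {Ω α β γ : Type*} [MeasurableSpace Ω] [MeasurableSpace α] [MeasurableSpace β]
  [MeasurableSpace γ] {P : Measure Ω}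

theorem integral_comp_prodMk_of_indepFun [IsFiniteMeasure P] {X : Ω → α} {Y : Ω → β}
    (hX : Measurable X) (hY : Measurable Y) (hXY : IndepFun X Y P) {F : α × β → ℝ}
    (hF : Measurable F) (hint : Integrable (fun ω => F (X ω, Y ω)) P) :
    ∫ ω, F (X ω, Y ω) ∂P = ∫ ω, ∫ ω', F (X ω, Y ω') ∂P ∂P := by
  have hlaw := (indepFun_iff_map_prod_eq_prod_map_map hX.aemeasurable hY.aemeasurable).1 hXY
  have hint' : Integrable F ((P.map X).prod (P.map Y)) := by
    rw [← hlaw]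
    exact (integrable_map_measure hF.aestronglyMeasurable (hX.prodMk hY).aemeasurable).2 hint
  have hinner : AEStronglyMeasurable (fun x => ∫ y, F (x, y) ∂P.map Y) (P.map X) :=
    hint'.aestronglyMeasurable.integral_prod_right'
  calc ∫ ω, F (X ω, Y ω) ∂P
      = ∫ z, F z ∂(P.map X).prod (P.map Y) := by
        rw [← hlaw, integral_map (hX.prodMk hY).aemeasurable hF.aestronglyMeasurable]
    _ = ∫ x, ∫ y, F (x, y) ∂P.map Y ∂P.map X := integral_prod F hint'
    _ = ∫ ω, ∫ y, F (X ω, y) ∂P.map Y ∂P := integral_map hX.aemeasurable hinner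
    _ = ∫ ω, ∫ ω', F (X ω, Y ω') ∂P ∂P := by
        refine integral_congr_ae (ae_of_all _ fun ω => integral_map hY.aemeasurable ?_)
        exact (hF.comp measurable_prodMk_left).aestronglyMeasurable

theorem measureReal_prodMk_mem_of_indepFun [IsFiniteMeasure P] {X : Ω → α} {Y : Ω → β}
    (hX : Measurable X) (hY : Measurable Y) (hXY : IndepFun X Y P) {B : Set (α × β)}
    (hB : MeasurableSet B) :
    P.real {ω | (X ω, Y ω) ∈ B} = ∫ ω, P.real {ω' | (X ω, Y ω') ∈ B} ∂P := by
  have hset : MeasurableSet {ω | (X ω, Y ω) ∈ B} := (hX.prodMk hY) hB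
  have hslice (x : α) : MeasurableSet {ω' | (x, Y ω') ∈ B} := (measurable_const.prodMk hY) hB
  have h := integral_comp_prodMk_of_indepFun hX hY hXY (F := B.indicator 1)
    (measurable_one.indicator hB) ((integrable_const (1 : ℝ)).indicator hset)
  rw [← integral_indicator_one hset]
  refine h.trans (integral_congr_ae (ae_of_all _ fun ω => ?_))
  exact integral_indicator_one (hslice (X ω))

theorem indepFun_prodMk_rotate [IsFiniteMeasure P] {X : Ω → α} {Y : Ω → β} {Z : Ω → γ}
    (hX : Measurable X) (hY : Measurable Y) (hZ : Measurable Z)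
    (hXYZ : IndepFun X (fun ω => (Y ω, Z ω)) P) (hYZ : IndepFun Y Z P) :
    IndepFun Y (fun ω => (X ω, Z ω)) P := by
  have hlaw : P.map (fun ω => (X ω, Z ω)) = (P.map X).prod (P.map Z) :=
    (indepFun_iff_map_prod_eq_prod_map_map hX.aemeasurable hZ.aemeasurable).1
      (hXYZ.comp measurable_id measurable_snd)
  rw [indepFun_iff_map_prod_eq_prod_map_map hY.aemeasurable (hX.prodMk hZ).aemeasurable, hlaw]
  refine Measure.ext_prod₃ fun {s t r} hs ht hr => ?_
  have hsr := hXYZ.measure_inter_preimage_eq_mul t (s ×ˢ r) ht (hs.prod hr)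
  have hYZ' := hYZ.measure_inter_preimage_eq_mul s r hs hr
  rw [Measure.prod_prod, Measure.prod_prod, Measure.map_apply hY hs, Measure.map_apply hX ht,
    Measure.map_apply hZ hr, Measure.map_apply (hY.prodMk (hX.prodMk hZ)) (hs.prod (ht.prod hr)),
    mul_left_comm, ← hYZ']
  refine Eq.trans (congrArg P ?_) hsr
  ext ω
  simp only [Set.mem_preimage, Set.mem_prod, Set.mem_inter_iff]
  tauto

theorem integral_finsetProd_comp_of_iIndepFun {ι : Type*} {h : ι → Ω → α}
    (hh : ∀ i, Measurable (h i)) (hind : iIndepFun h P) {f : ι → α → ℝ}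
    (hf : ∀ i, Measurable (f i)) (s : Finset ι) :
    ∫ ω, ∏ i ∈ s, f i (h i ω) ∂P = ∏ i ∈ s, ∫ y, f i y ∂P.map (h i) := by
  have hind' := (hind.precomp (g := fun i : s => (i : ι)) Subtype.val_injective).comp
    (fun i => f i) fun i => hf i
  have h := hind'.integral_fun_prod_eq_prod_integral fun i =>
    ((hf i).comp (hh i)).aestronglyMeasurable
  simp_rw [← Finset.prod_coe_sort s]
  refine h.trans (Finset.prod_congr rfl fun i _ => ?_)
  exact (integral_map (hh i).aemeasurable (hf i).aestronglyMeasurable).symm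

end Independence

/-! ### Spherical coordinates around an axis -/

section Zonal

open Set InnerProductGeometry
open scoped Real Pointwise

@[fun_prop]
theorem measurable_angle {α V : Type*} [MeasurableSpace α] [NormedAddCommGroup V]
    [InnerProductSpace ℝ V] [MeasurableSpace V] [BorelSpace V] [SecondCountableTopology V]
    {f g : α → V} (hf : Measurable f) (hg : Measurable g) :
    Measurable fun a => angle (f a) (g a) :=
  Real.measurable_arccos.comp (by fun_prop)

theorem lintegral_comp_sqrt_sq_add_sq {F : ℝ → ℝ≥0∞} (hF : Measurable F) :
    ∫⁻ q : ℝ × ℝ, F √(q.1 ^ 2 + q.2 ^ 2) =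
      ∫⁻ ρ in Ioi (0 : ℝ), ENNReal.ofReal (2 * π * ρ) * F ρ := by
  have norm_polar (p : ℝ × ℝ) (hp : p ∈ polarCoord.target) :
      ENNReal.ofReal p.1 • F √((polarCoord.symm p).1 ^ 2 + (polarCoord.symm p).2 ^ 2) =
        ENNReal.ofReal p.1 * F p.1 := by
    have hsq : (polarCoord.symm p).1 ^ 2 + (polarCoord.symm p).2 ^ 2 = p.1 ^ 2 := by
      rw [polarCoord_symm_apply]
      linear_combination p.1 ^ 2 * Real.sin_sq_add_cos_sq p.2
    rw [hsq, Real.sqrt_sq hp.1.le, smul_eq_mul]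
  rw [← lintegral_comp_polarCoord_symm,
    setLIntegral_congr_fun polarCoord.open_target.measurableSet norm_polar, polarCoord_target,
    Measure.volume_eq_prod, setLIntegral_prod _ (by fun_prop)]
  refine lintegral_congr fun ρ => ?_
  dsimp only
  rw [setLIntegral_const, Real.volume_Ioo, mul_right_comm,
    ← ENNReal.ofReal_mul' (by linarith [Real.pi_pos])]
  ring_nf

theorem lintegral_comp_cylindrical {F : ℝ × ℝ → ℝ≥0∞} (hF : Measurable F) :
    ∫⁻ y : E3, F (y 0, √(y 1 ^ 2 + y 2 ^ 2)) =
      ∫⁻ p in univ ×ˢ Ioi (0 : ℝ), ENNReal.ofReal (2 * π * p.2) * F p := by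
  have e₁ := (PiLp.volume_preserving_ofLp (Fin 3)).lintegral_comp_emb
    (MeasurableEquiv.toLp 2 (Fin 3 → ℝ)).symm.measurableEmbedding
    (fun y : Fin 3 → ℝ => F (y 0, √(y 1 ^ 2 + y 2 ^ 2)))
  have e₂ := (volume_preserving_piFinSuccAbove (fun _ : Fin 3 => ℝ) 0).lintegral_comp_emb
    (MeasurableEquiv.measurableEmbedding _)
    (fun q : ℝ × (Fin 2 → ℝ) => F (q.1, √(q.2 0 ^ 2 + q.2 1 ^ 2)))
  have e₃ (z : ℝ) := (volume_preserving_finTwoArrow ℝ).lintegral_comp_emb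
    (MeasurableEquiv.measurableEmbedding _) (fun q : ℝ × ℝ => F (z, √(q.1 ^ 2 + q.2 ^ 2)))
  refine e₁.trans (e₂.trans ?_)
  rw [Measure.volume_eq_prod, lintegral_prod _ (by fun_prop), Measure.volume_eq_prod,
    setLIntegral_prod _ (by fun_prop), setLIntegral_univ]
  exact lintegral_congr fun z => (e₃ z).trans
    (lintegral_comp_sqrt_sq_add_sq (F := fun ρ => F (z, ρ)) (by fun_prop))

theorem setLIntegral_upperHalfPlane_eq_polar {F : ℝ × ℝ → ℝ≥0∞} :
    ∫⁻ p in univ ×ˢ Ioi (0 : ℝ), F p =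
      ∫⁻ q in Ioi (0 : ℝ) ×ˢ Ioo 0 π,
        ENNReal.ofReal q.1 * F (q.1 * Real.cos q.2, q.1 * Real.sin q.2) := by
  have hmem (q : ℝ × ℝ) (hq : q ∈ polarCoord.target) :
      ENNReal.ofReal q.1 • (univ ×ˢ Ioi (0 : ℝ)).indicator F (polarCoord.symm q) =
        (univ ×ˢ Ioo 0 π).indicator
          (fun q => ENNReal.ofReal q.1 * F (q.1 * Real.cos q.2, q.1 * Real.sin q.2)) q := by
    obtain ⟨hr : 0 < q.1, hθ⟩ := hq
    rw [polarCoord_symm_apply]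
    by_cases h : 0 < q.2
    · have hs : 0 < Real.sin q.2 := Real.sin_pos_of_pos_of_lt_pi h hθ.2
      rw [indicator_of_mem (by simp [hr, hs]), indicator_of_mem (by simp [h, hθ.2]), smul_eq_mul]
    · have hs : Real.sin q.2 ≤ 0 := Real.sin_nonpos_of_nonpos_of_neg_pi_le (not_lt.1 h) hθ.1.le
      rw [indicator_of_notMem (by simp [hr, hs]), indicator_of_notMem (by simp [h]), smul_zero]
  rw [← lintegral_indicator (MeasurableSet.univ.prod measurableSet_Ioi),
    ← lintegral_comp_polarCoord_symm,
    setLIntegral_congr_fun polarCoord.open_target.measurableSet hmem, polarCoord_target,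
    lintegral_indicator (MeasurableSet.univ.prod measurableSet_Ioo),
    Measure.restrict_restrict (MeasurableSet.univ.prod measurableSet_Ioo), prod_inter_prod,
    univ_inter, inter_eq_left.2 (Ioo_subset_Ioo_left (by linarith [Real.pi_pos]))]

theorem exists_orthonormalBasis_zero_eq {e : E3} (he : e ≠ 0) :
    ∃ b : OrthonormalBasis (Fin 3) ℝ E3, b 0 = ‖e‖⁻¹ • e := by
  have hv : Orthonormal ℝ (({0} : Set (Fin 3)).domRestrict (fun _ : Fin 3 => ‖e‖⁻¹ • e)) := by
    rw [orthonormal_iff_ite]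
    rintro ⟨i, rfl⟩ ⟨j, rfl⟩
    change inner ℝ (‖e‖⁻¹ • e) (‖e‖⁻¹ • e) = _
    simp [norm_smul, he]
  obtain ⟨b, hb⟩ := hv.exists_orthonormalBasis_extension_of_card_eq (by simp)
  exact ⟨b, hb 0 rfl⟩

theorem lintegral_comp_norm_angle {F : ℝ × ℝ → ℝ≥0∞} (hF : Measurable F) {e : E3} (he : e ≠ 0) :
    ∫⁻ y : E3, F (‖y‖, angle e y) =
      ∫⁻ p in Ioi (0 : ℝ) ×ˢ Ioo 0 π,
        ENNReal.ofReal (2 * π * p.1 ^ 2 * Real.sin p.2) * F p := by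
  obtain ⟨b, hb⟩ := exists_orthonormalBasis_zero_eq he
  let H (p : ℝ × ℝ) : ℝ≥0∞ :=
    F (√(p.1 ^ 2 + p.2 ^ 2), Real.arccos (p.1 / √(p.1 ^ 2 + p.2 ^ 2)))
  have hH : Measurable H :=
    hF.comp (.prodMk (by fun_prop) (Real.measurable_arccos.comp (by fun_prop)))
  have coordinates (y : E3) :
      F (‖y‖, angle e y) = H ((b.repr y) 0, √((b.repr y) 1 ^ 2 + (b.repr y) 2 ^ 2)) := by
    have hnorm : √((b.repr y) 0 ^ 2 + √((b.repr y) 1 ^ 2 + (b.repr y) 2 ^ 2) ^ 2) = ‖y‖ := by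
      rw [← b.repr.norm_map y, EuclideanSpace.norm_eq, Real.sq_sqrt (by positivity)]
      simp [Fin.sum_univ_three, add_assoc]
    have hinner : (b.repr y) 0 = inner ℝ e y / ‖e‖ := by
      rw [b.repr_apply_apply, hb, real_inner_smul_left, inv_mul_eq_div]
    simp only [H, hnorm]
    rw [hinner, angle, div_div]
  have polar (p : ℝ × ℝ) (hp : p ∈ Ioi (0 : ℝ) ×ˢ Ioo 0 π) :
      H (p.1 * Real.cos p.2, p.1 * Real.sin p.2) = F p := by
    obtain ⟨hr : 0 < p.1, hθ⟩ := hp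
    have hsq : (p.1 * Real.cos p.2) ^ 2 + (p.1 * Real.sin p.2) ^ 2 = p.1 ^ 2 := by
      linear_combination p.1 ^ 2 * Real.sin_sq_add_cos_sq p.2
    simp only [H, hsq, Real.sqrt_sq hr.le, mul_div_cancel_left₀ _ hr.ne',
      Real.arccos_cos hθ.1.le hθ.2.le]
  have rotate := b.measurePreserving_repr.lintegral_comp_emb
    b.repr.toHomeomorph.measurableEmbedding (fun y : E3 => H (y 0, √(y 1 ^ 2 + y 2 ^ 2)))
  rw [lintegral_congr coordinates, rotate, lintegral_comp_cylindrical hH,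
    setLIntegral_upperHalfPlane_eq_polar]
  refine setLIntegral_congr_fun (measurableSet_Ioi.prod measurableSet_Ioo) fun p hp => ?_
  dsimp only
  rw [polar p hp, ← mul_assoc, ← ENNReal.ofReal_mul (le_of_lt hp.1)]
  ring_nf

theorem smul_image_sphere_angle_mem_eq {V : Type*} [NormedAddCommGroup V] [InnerProductSpace ℝ V]
    (e : V) (A : Set ℝ) :
    Ioo (0 : ℝ) 1 • (Subtype.val '' {z : Metric.sphere (0 : V) 1 | angle e (z : V) ∈ A}) =
      {y : V | ‖y‖ ∈ Ioo (0 : ℝ) 1 ∧ angle e y ∈ A} := by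
  ext y
  simp only [mem_smul, mem_image, mem_ofPred_eq]
  constructor
  · rintro ⟨r, hr, _, ⟨z, hz, rfl⟩, rfl⟩
    rw [angle_smul_right_of_pos _ _ hr.1, norm_smul, norm_eq_of_mem_sphere, mul_one,
      Real.norm_of_nonneg hr.1.le]
    exact ⟨hr, hz⟩
  · rintro ⟨hy, hyA⟩
    refine ⟨‖y‖, hy, ‖y‖⁻¹ • y, ⟨⟨‖y‖⁻¹ • y, ?_⟩, ?_, rfl⟩, smul_inv_smul₀ hy.1.ne' y⟩
    · simp [norm_smul, hy.1.ne']
    · rwa [angle_smul_right_of_pos _ _ (inv_pos.2 hy.1)]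

theorem lintegral_Ioo_zero_one_sq :
    ∫⁻ r in Ioo (0 : ℝ) 1, ENNReal.ofReal (r ^ 2) = ENNReal.ofReal (1 / 3) := by
  rw [← ofReal_integral_eq_lintegral_ofReal, ← integral_Ioc_eq_integral_Ioo,
    ← intervalIntegral.integral_of_le zero_le_one, integral_pow]
  · norm_num
  · exact ((continuous_pow 2).integrableOn_Icc (a := 0) (b := 1)).mono_set Ioo_subset_Icc_self
  · exact ae_of_all _ fun r => sq_nonneg r

theorem volume_norm_lt_one_angle_mem {e : E3} (he : e ≠ 0) {A : Set ℝ} (hA : MeasurableSet A) :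
    volume {y : E3 | ‖y‖ ∈ Ioo (0 : ℝ) 1 ∧ angle e y ∈ A} =
      ENNReal.ofReal (1 / 3) *
        ∫⁻ θ in A ∩ Ioo 0 π, ENNReal.ofReal (2 * π * Real.sin θ) := by
  have hA' : MeasurableSet (Ioo (0 : ℝ) 1 ×ˢ A) := measurableSet_Ioo.prod hA
  have hcone : MeasurableSet {y : E3 | ‖y‖ ∈ Ioo (0 : ℝ) 1 ∧ angle e y ∈ A} :=
    (measurable_norm measurableSet_Ioo).inter ((measurable_angle measurable_const measurable_id) hA)
  have hdensity (p : ℝ × ℝ) : ENNReal.ofReal (2 * π * p.1 ^ 2 * Real.sin p.2) *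
      (Ioo (0 : ℝ) 1 ×ˢ A).indicator 1 p = (Ioo (0 : ℝ) 1 ×ˢ A).indicator
        (fun p => ENNReal.ofReal (p.1 ^ 2) * ENNReal.ofReal (2 * π * Real.sin p.2)) p := by
    by_cases hp : p ∈ Ioo (0 : ℝ) 1 ×ˢ A
    · rw [indicator_of_mem hp, indicator_of_mem hp, ← ENNReal.ofReal_mul (by positivity),
        Pi.one_apply, mul_one]
      ring_nf
    · rw [indicator_of_notMem hp, indicator_of_notMem hp, mul_zero]
  calc volume {y : E3 | ‖y‖ ∈ Ioo (0 : ℝ) 1 ∧ angle e y ∈ A}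
      = ∫⁻ y : E3, (Ioo (0 : ℝ) 1 ×ˢ A).indicator 1 (‖y‖, angle e y) := by
        rw [← lintegral_indicator_one hcone]; rfl
    _ = ∫⁻ p in Ioo (0 : ℝ) 1 ×ˢ (A ∩ Ioo 0 π),
          ENNReal.ofReal (p.1 ^ 2) * ENNReal.ofReal (2 * π * Real.sin p.2) := by
        rw [lintegral_comp_norm_angle (measurable_one.indicator hA') he,
          lintegral_congr hdensity, lintegral_indicator hA', Measure.restrict_restrict hA',
          prod_inter_prod, inter_eq_left.2 Ioo_subset_Ioi_self]
    _ = _ := by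
        rw [Measure.volume_eq_prod, ← Measure.prod_restrict,
          lintegral_prod_mul (f := fun r : ℝ => ENNReal.ofReal (r ^ 2))
            (g := fun θ => ENNReal.ofReal (2 * π * Real.sin θ)) (by fun_prop) (by fun_prop),
          lintegral_Ioo_zero_one_sq]

theorem toSphere_angle_mem {e : E3} (he : e ≠ 0) {A : Set ℝ} (hA : MeasurableSet A) :
    (volume : Measure E3).toSphere {z | angle e (z : E3) ∈ A} =
      ∫⁻ θ in A ∩ Ioo 0 π, ENNReal.ofReal (2 * π * Real.sin θ) := by
  have hms : MeasurableSet {z : Metric.sphere (0 : E3) 1 | angle e (z : E3) ∈ A} :=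
    measurable_angle measurable_const measurable_subtype_coe hA
  have hdim : ((Module.finrank ℝ E3 : ℕ) : ℝ≥0∞) * ENNReal.ofReal (1 / 3) = 1 := by
    rw [finrank_euclideanSpace_fin, ← ENNReal.ofReal_natCast, ← ENNReal.ofReal_mul (by positivity)]
    norm_num
  rw [Measure.toSphere_apply' _ hms, smul_image_sphere_angle_mem_eq,
    volume_norm_lt_one_angle_mem he hA, ← mul_assoc, hdim, one_mul]

theorem map_angle_sphereArea {e : E3} (he : e ≠ 0) {R : ℝ} (hR : 0 < R) :
    (sphereArea R).map (fun y => angle e y) =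
      (volume.restrict (Ioo 0 π)).withDensity
        (fun θ => ENNReal.ofReal (2 * π * R ^ 2 * Real.sin θ)) := by
  have hangle : Measurable fun y : E3 => angle e y := by fun_prop
  ext A hA
  have hscale :
      (fun z : Metric.sphere (0 : E3) 1 => R • (z : E3)) ⁻¹' ((fun y => angle e y) ⁻¹' A) =
        {z : Metric.sphere (0 : E3) 1 | angle e (z : E3) ∈ A} := by
    ext z
    simp [angle_smul_right_of_pos _ _ hR]
  rw [Measure.map_apply hangle hA, sphereArea, Measure.smul_apply,
    Measure.map_apply (by fun_prop) (hangle hA), hscale, toSphere_angle_mem he hA,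
    withDensity_apply _ hA, Measure.restrict_restrict hA, smul_eq_mul,
    ← lintegral_const_mul _ (by fun_prop)]
  refine lintegral_congr fun θ => ?_
  rw [← ENNReal.ofReal_mul (by positivity)]
  ring_nf

theorem ae_norm_sphereArea {R : ℝ} (hR : 0 ≤ R) : ∀ᵐ y ∂sphereArea R, ‖y‖ = R := by
  refine Measure.ae_smul_measure ?_ _
  rw [ae_map_iff (by fun_prop) (measurableSet_eq_fun (by fun_prop) (by fun_prop))]
  refine ae_of_all _ fun z => ?_
  rw [norm_smul, norm_eq_of_mem_sphere, mul_one, Real.norm_of_nonneg hR]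

theorem integral_comp_angle_sphereArea {e : E3} (he : e ≠ 0) {R : ℝ} (hR : 0 < R) {g : ℝ → ℝ}
    (hg : Measurable g) :
    ∫ y, g (angle e y) ∂sphereArea R = 2 * π * R ^ 2 * ∫ θ in (0 : ℝ)..π, g θ * Real.sin θ := by
  have hangle : Measurable fun y : E3 => angle e y := by fun_prop
  rw [← integral_map hangle.aemeasurable hg.aestronglyMeasurable, map_angle_sphereArea he hR,
    integral_withDensity_eq_integral_toReal_smul (by fun_prop)
      (ae_of_all _ fun _ => ENNReal.ofReal_lt_top),
    intervalIntegral.integral_of_le Real.pi_pos.le, integral_Ioc_eq_integral_Ioo,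
    ← integral_const_mul]
  refine setIntegral_congr_fun measurableSet_Ioo fun θ hθ => ?_
  have : 0 < Real.sin θ := Real.sin_pos_of_mem_Ioo hθ
  rw [ENNReal.toReal_ofReal (by positivity), smul_eq_mul]
  ring

theorem sphereArea_real_univ {R : ℝ} (hR : 0 < R) : (sphereArea R).real univ = 4 * π * R ^ 2 := by
  have h := integral_comp_angle_sphereArea (e := EuclideanSpace.single 0 1) (by simp) hR
    (g := fun _ => 1) measurable_const
  simp only [integral_const, smul_eq_mul, mul_one, one_mul, integral_sin, Real.cos_zero,
    Real.cos_pi] at h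
  rw [h]
  ring

theorem integral_comp_angle_uniformSphere {e : E3} (he : e ≠ 0) {R : ℝ} (hR : 0 < R) {g : ℝ → ℝ}
    (hg : Measurable g) :
    ∫ y, g (angle e y) ∂uniformSphere R = ∫ θ in (0 : ℝ)..π, g θ * (Real.sin θ / 2) := by
  rw [uniformSphere, integral_smul_measure, integral_comp_angle_sphereArea he hR hg,
    ENNReal.toReal_inv, ← measureReal_def, sphereArea_real_univ hR, smul_eq_mul, ← mul_assoc,
    ← intervalIntegral.integral_const_mul]
  refine intervalIntegral.integral_congr fun θ _ => ?_
  have := Real.pi_pos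
  field_simp
  norm_num

end Zonal

/-! ### The Laplace functional of a marked Poisson process -/

section PoissonProcess

theorem measurable_sum_range_count {α : Type*} [MeasurableSpace α] {n : α → ℕ} (hn : Measurable n)
    {f : ℕ → α → ℝ} (hf : ∀ i, Measurable (f i)) :
    Measurable fun a => ∑ i ∈ Finset.range (n a), f i a := by
  have : Measurable fun p : ℕ × α => ∑ i ∈ Finset.range p.1, f i p.2 :=
    measurable_from_prod_countable_right fun k =>
      Finset.measurable_fun_sum (Finset.range k) fun i _ => hf i
  exact this.comp (hn.prodMk measurable_id)

theorem measurable_prod_range_count {α : Type*} [MeasurableSpace α] {n : α → ℕ} (hn : Measurable n)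
    {f : ℕ → α → ℝ} (hf : ∀ i, Measurable (f i)) :
    Measurable fun a => ∏ i ∈ Finset.range (n a), f i a := by
  have : Measurable fun p : ℕ × α => ∏ i ∈ Finset.range p.1, f i p.2 :=
    measurable_from_prod_countable_right fun k =>
      Finset.measurable_fun_prod (Finset.range k) fun i _ => hf i
  exact this.comp (hn.prodMk measurable_id)

theorem abs_finsetProd_le_one {ι : Type*} {s : Finset ι} {f : ι → ℝ} (hf : ∀ i ∈ s, |f i| ≤ 1) :
    |∏ i ∈ s, f i| ≤ 1 := by
  rw [Finset.abs_prod]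
  exact Finset.prod_le_one (fun i _ => abs_nonneg _) hf

theorem integral_pow_poissonMeasure (r : ℝ≥0) (c : ℝ) :
    ∫ n, c ^ n ∂poissonMeasure r = Real.exp (-(r * (1 - c))) := by
  have h : HasSum (fun n : ℕ => (Real.exp (-r) * r ^ n / n !) • c ^ n)
      (Real.exp (-r) * Real.exp (r * c)) := by
    have := (NormedSpace.expSeries_div_hasSum_exp ((r : ℝ) * c)).mul_left (Real.exp (-r))
    rw [← Real.exp_eq_exp_ℝ] at this
    refine this.congr_fun fun n => ?_
    rw [smul_eq_mul, mul_pow]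
    ring
  rw [integral_poissonMeasure, h.tsum_eq, ← Real.exp_add]
  ring_nf

theorem prod_simpleFunc_comp_eq_prod_pow_pointCount {Ω E : Type*} [MeasurableSpace E] {n : Ω → ℕ}
    {u : ℕ → Ω → E} (g : SimpleFunc E ℝ) (ω : Ω) :
    ∏ i ∈ Finset.range (n ω), g (u i ω) = ∏ c ∈ g.range, c ^ pointCount n u (g ⁻¹' {c}) ω := by
  classical
  refine (Finset.prod_fiberwise_of_maps_to' (fun i _ => g.mem_range_self (u i ω))
    fun c => c).symm.trans (Finset.prod_congr rfl fun c _ => ?_)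
  rw [Finset.prod_const, pointCount]
  congr!

variable {Ω E M : Type*} [MeasurableSpace Ω] [MeasurableSpace E] [MeasurableSpace M]
  {P : Measure Ω} {Λ : Measure E} {n : Ω → ℕ} {u : ℕ → Ω → E} {h : ℕ → Ω → M} {μ : Measure M}

theorem integral_one_sub_simpleFunc [IsFiniteMeasure Λ] (g : SimpleFunc E ℝ) :
    ∫ x, (1 - g x) ∂Λ = ∑ c ∈ g.range, Λ.real (g ⁻¹' {c}) * (1 - c) := by
  have hint : Integrable g Λ := g.integrable_of_isFiniteMeasure
  have hmass : ∑ c ∈ g.range, Λ.real (g ⁻¹' {c}) = Λ.real Set.univ := by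
    rw [sum_measureReal_preimage_singleton _ fun c _ => g.measurableSet_fiber c,
      g.coe_range, Set.preimage_range]
  rw [integral_sub (integrable_const _) hint, integral_const, SimpleFunc.integral_eq_sum g hint]
  simp only [mul_sub, mul_one, Finset.sum_sub_distrib, hmass, smul_eq_mul]

namespace IsPoissonProcess

theorem integral_prod_simpleFunc [IsProbabilityMeasure P] (hp : IsPoissonProcess P Λ n u)
    (g : SimpleFunc E ℝ) :
    ∫ ω, ∏ i ∈ Finset.range (n ω), g (u i ω) ∂P = Real.exp (-∫ x, (1 - g x) ∂Λ) := by
  have : IsFiniteMeasure Λ := ⟨hp.finite_intensity⟩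
  let N (c : g.range) : Ω → ℕ := pointCount n u (g ⁻¹' {(c : ℝ)})
  have hm (c : ℝ) : MeasurableSet (g ⁻¹' {c}) := g.measurableSet_fiber c
  have hN (c) : AEMeasurable (N c) P := by
    refine AEMeasurable.of_map_ne_zero ?_
    rw [hp.poisson_law _ (hm c)]
    exact IsProbabilityMeasure.ne_zero _
  have hind : iIndepFun N P := by
    have h := hp.indep_disjoint _ (fun j => g ⁻¹' {(g.range.equivFin.symm j : ℝ)})
      (fun j => hm _) fun i j hij => Disjoint.preimage _ (by simpa [Subtype.val_inj] using hij)
    simpa [N] using h.precomp g.range.equivFin.injective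
  have hpow (c : g.range) : ∫ ω, (c : ℝ) ^ N c ω ∂P =
      Real.exp (-(Λ.real (g ⁻¹' {(c : ℝ)}) * (1 - c))) := by
    have h := integral_map (hN c) (f := fun k : ℕ => (c : ℝ) ^ k)
      (measurable_of_countable _).aestronglyMeasurable
    rw [hp.poisson_law _ (hm c), integral_pow_poissonMeasure] at h
    exact h.symm
  calc ∫ ω, ∏ i ∈ Finset.range (n ω), g (u i ω) ∂P
      = ∫ ω, ∏ c : g.range, (c : ℝ) ^ N c ω ∂P := by
        refine integral_congr_ae (ae_of_all _ fun ω => ?_)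
        exact (prod_simpleFunc_comp_eq_prod_pow_pointCount g ω).trans
          (Finset.prod_coe_sort _ _).symm
    _ = ∏ c : g.range, ∫ ω, (c : ℝ) ^ N c ω ∂P :=
        (hind.comp (fun c k => (c : ℝ) ^ k) fun c => measurable_of_countable _)
          |>.integral_fun_prod_eq_prod_integral fun c =>
            ((measurable_of_countable _).comp_aemeasurable (hN c)).aestronglyMeasurable
    _ = Real.exp (-∫ x, (1 - g x) ∂Λ) := by
        simp_rw [hpow]
        rw [← Real.exp_sum, Finset.sum_neg_distrib, integral_one_sub_simpleFunc,
          ← Finset.sum_coe_sort g.range]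

theorem integral_prod_comp [IsProbabilityMeasure P] (hp : IsPoissonProcess P Λ n u) {g : E → ℝ}
    (hg : Measurable g) (hg1 : ∀ x, |g x| ≤ 1) :
    ∫ ω, ∏ i ∈ Finset.range (n ω), g (u i ω) ∂P = Real.exp (-∫ x, (1 - g x) ∂Λ) := by
  have : IsFiniteMeasure Λ := ⟨hp.finite_intensity⟩
  let G (k : ℕ) : SimpleFunc E ℝ := SimpleFunc.approxOn g hg (Set.Icc (-1 : ℝ) 1) 0 (by simp) k
  have hG (k : ℕ) (x : E) : |G k x| ≤ 1 :=
    abs_le.2 (Set.mem_Icc.1 (SimpleFunc.approxOn_mem hg _ k x))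
  have hlim (x : E) : Filter.Tendsto (fun k => G k x) Filter.atTop (nhds (g x)) :=
    SimpleFunc.tendsto_approxOn _ _ (subset_closure (abs_le.1 (hg1 x)))
  have hlhs : Filter.Tendsto (fun k => ∫ ω, ∏ i ∈ Finset.range (n ω), G k (u i ω) ∂P) Filter.atTop
      (nhds (∫ ω, ∏ i ∈ Finset.range (n ω), g (u i ω) ∂P)) := by
    refine tendsto_integral_of_dominated_convergence (fun _ => 1) (fun k => ?_)
      (integrable_const _) (fun k => ae_of_all _ fun ω => ?_) (ae_of_all _ fun ω => ?_)
    · exact (measurable_prod_range_count hp.measurable_count fun i =>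
        (G k).measurable.comp (hp.measurable_point i)).aestronglyMeasurable
    · exact abs_finsetProd_le_one fun i _ => hG k _
    · exact tendsto_finsetProd _ fun i _ => hlim _
  have hrhs : Filter.Tendsto (fun k => ∫ x, (1 - G k x) ∂Λ) Filter.atTop
      (nhds (∫ x, (1 - g x) ∂Λ)) := by
    refine tendsto_integral_of_dominated_convergence (fun _ => 2) (fun k => ?_)
      (integrable_const _) (fun k => ae_of_all _ fun x => ?_) (ae_of_all _ fun x => ?_)
    · exact (measurable_const.sub (G k).measurable).aestronglyMeasurable
    · exact abs_le.2 ⟨by linarith [abs_le.1 (hG k x)], by linarith [abs_le.1 (hG k x)]⟩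
    · exact (hlim x).const_sub 1
  refine tendsto_nhds_unique hlhs ?_
  simp_rw [hp.integral_prod_simpleFunc]
  exact (Real.continuous_exp.tendsto _).comp hrhs.neg

theorem integral_prod_comp_mark [IsProbabilityMeasure P] (hp : IsPoissonProcess P Λ n u)
    (hh : ∀ i, Measurable (h i)) (hlaw : ∀ i, P.map (h i) = μ) (hind : iIndepFun h P)
    (hindep : IndepFun (fun ω => (n ω, fun i => u i ω)) (fun ω i => h i ω) P)
    {g : E × M → ℝ} (hg : Measurable g) (hg1 : ∀ᵐ y ∂μ, ∀ x, |g (x, y)| ≤ 1) :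
    ∫ ω, ∏ i ∈ Finset.range (n ω), g (u i ω, h i ω) ∂P =
      Real.exp (-∫ x, (1 - ∫ y, g (x, y) ∂μ) ∂Λ) := by
  have : IsProbabilityMeasure μ := hlaw 0 ▸ Measure.isProbabilityMeasure_map (hh 0).aemeasurable
  have hpoints : Measurable fun ω => (n ω, fun i => u i ω) :=
    hp.measurable_count.prodMk (measurable_pi_lambda _ hp.measurable_point)
  have hmarks : Measurable fun ω i => h i ω := measurable_pi_lambda _ hh
  have hF : Measurable fun z : (ℕ × (ℕ → E)) × (ℕ → M) =>
      ∏ i ∈ Finset.range z.1.1, g (z.1.2 i, z.2 i) :=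
    measurable_prod_range_count (by fun_prop) fun i => hg.comp (by fun_prop)
  have hbound : ∀ᵐ ω ∂P, |∏ i ∈ Finset.range (n ω), g (u i ω, h i ω)| ≤ 1 := by
    have hmark : ∀ᵐ ω ∂P, ∀ i x, |g (x, h i ω)| ≤ 1 := ae_all_iff.2 fun i =>
      ae_of_ae_map (hh i).aemeasurable (by rwa [hlaw i])
    filter_upwards [hmark] with ω hω using abs_finsetProd_le_one fun i _ => hω i _
  have hmean (x : E) : |∫ y, g (x, y) ∂μ| ≤ 1 := by
    simpa using norm_integral_le_of_norm_le_const (f := fun y => g (x, y)) (C := 1)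
      (hg1.mono fun y hy => hy x)
  calc ∫ ω, ∏ i ∈ Finset.range (n ω), g (u i ω, h i ω) ∂P
      = ∫ ω, ∫ ω', ∏ i ∈ Finset.range (n ω), g (u i ω, h i ω') ∂P ∂P :=
        integral_comp_prodMk_of_indepFun hpoints hmarks hindep hF
          (.of_bound (hF.comp (hpoints.prodMk hmarks)).aestronglyMeasurable 1 hbound)
    _ = ∫ ω, ∏ i ∈ Finset.range (n ω), ∫ y, g (u i ω, y) ∂μ ∂P := by
        refine integral_congr_ae (ae_of_all _ fun ω => ?_)
        simpa only [hlaw] using integral_finsetProd_comp_of_iIndepFun hh hind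
          (f := fun i y => g (u i ω, y)) (fun i => hg.comp measurable_prodMk_left) _
    _ = Real.exp (-∫ x, (1 - ∫ y, g (x, y) ∂μ) ∂Λ) :=
        hp.integral_prod_comp hg.stronglyMeasurable.integral_prod_right'.measurable hmean

theorem integral_exp_neg_sum_mul_mark [IsProbabilityMeasure P] (hp : IsPoissonProcess P Λ n u)
    {h : ℕ → Ω → ℝ} {μ : Measure ℝ} (hh : ∀ i, Measurable (h i)) (hlaw : ∀ i, P.map (h i) = μ)
    (hμ : ∀ᵐ y ∂μ, 0 ≤ y) (hind : iIndepFun h P)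
    (hindep : IndepFun (fun ω => (n ω, fun i => u i ω)) (fun ω i => h i ω) P)
    {f : E → ℝ} (hf : Measurable f) (hf0 : ∀ x, 0 ≤ f x) :
    ∫ ω, Real.exp (-∑ i ∈ Finset.range (n ω), f (u i ω) * h i ω) ∂P =
      Real.exp (-∫ x, (1 - ∫ y, Real.exp (-(f x * y)) ∂μ) ∂Λ) := by
  simp_rw [← Finset.sum_neg_distrib, Real.exp_sum]
  refine hp.integral_prod_comp_mark (g := fun z => Real.exp (-(f z.1 * z.2))) hh hlaw hind hindep
    (by fun_prop) ?_
  filter_upwards [hμ] with y hy x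
  rw [Real.abs_exp, Real.exp_le_one_iff, neg_nonpos]
  exact mul_nonneg (hf0 x) hy

end IsPoissonProcess

end PoissonProcess

/-! ### The Gamma law and Alzer's inequality -/

section Gamma

open Set Filter
open scoped Topology

theorem ae_nonneg_gammaMeasure (a r : ℝ) : ∀ᵐ x ∂gammaMeasure a r, 0 ≤ x := by
  rw [ae_iff]
  simp only [not_le]
  change gammaMeasure a r (Iio 0) = 0
  rw [gammaMeasure, withDensity_apply _ measurableSet_Iio, lintegral_gammaPDF_of_nonpos le_rfl]

theorem integral_exp_neg_mul_gammaMeasure {a r t : ℝ} (ha : 0 < a) (hr : 0 < r)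
    (ht : 0 < r + t) :
    ∫ x, Real.exp (-(t * x)) ∂gammaMeasure a r = (r / (r + t)) ^ a := by
  have := Real.Gamma_pos_of_pos ha
  have hpdf : ∀ x ∈ Ioi (0 : ℝ), (gammaPDF a r x).toReal • Real.exp (-(t * x)) =
      r ^ a / Real.Gamma a * (x ^ (a - 1) * Real.exp (-((r + t) * x))) := by
    intro x (hx : 0 < x)
    rw [gammaPDF_of_nonneg hx.le, ENNReal.toReal_ofReal (by positivity), smul_eq_mul, add_mul,
      neg_add, Real.exp_add]
    ring
  have hneg (x : ℝ) (hx : x ∉ Ici 0) : (gammaPDF a r x).toReal • Real.exp (-(t * x)) = 0 := by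
    rw [gammaPDF_of_neg (by simpa using hx), ENNReal.toReal_zero, zero_smul]
  rw [gammaMeasure, integral_withDensity_eq_integral_toReal_smul (f := gammaPDF a r)
      (measurable_gammaPDFReal _ _).ennreal_ofReal (ae_of_all _ fun _ => ENNReal.ofReal_lt_top),
    ← setIntegral_eq_integral_of_forall_compl_eq_zero hneg, integral_Ici_eq_integral_Ioi,
    setIntegral_congr_fun measurableSet_Ioi hpdf, integral_const_mul,
    Real.integral_rpow_mul_exp_neg_mul_Ioi ha ht, Real.div_rpow hr.le ht.le,
    Real.div_rpow zero_le_one ht.le, Real.one_rpow]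
  field_simp

theorem integrable_gammaPDFReal {a r : ℝ} (ha : 0 < a) (hr : 0 < r) :
    Integrable (gammaPDFReal a r) := by
  refine ⟨(measurable_gammaPDFReal a r).aestronglyMeasurable, ?_⟩
  rw [hasFiniteIntegral_iff_ofReal (ae_of_all _ (gammaPDFReal_nonneg ha hr))]
  exact (lintegral_gammaPDF_eq_one ha hr).trans_lt ENNReal.one_lt_top

theorem cdf_gammaMeasure_zero {a r : ℝ} (ha : 0 < a) (hr : 0 < r) :
    cdf (gammaMeasure a r) 0 = 0 := by
  rw [cdf_gammaMeasure_eq_lintegral ha hr, setLIntegral_congr Iio_ae_eq_Iic.symm,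
    lintegral_gammaPDF_of_nonpos le_rfl, ENNReal.toReal_zero]

theorem cdf_gammaMeasure_one {r : ℝ} (hr : 0 < r) {x : ℝ} (hx : 0 ≤ x) :
    cdf (gammaMeasure 1 r) x = 1 - Real.exp (-(r * x)) := by
  have := cdf_expMeasure_eq hr x
  rwa [if_pos hx] at this

theorem hasDerivAt_cdf_gammaMeasure {a r : ℝ} (ha : 0 < a) (hr : 0 < r) {x : ℝ} (hx : 0 < x) :
    HasDerivAt (cdf (gammaMeasure a r)) (gammaPDFReal a r x) x := by
  have hint := integrable_gammaPDFReal ha hr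
  have hcont : ContinuousAt (gammaPDFReal a r) x := by
    have : ContinuousAt (fun x : ℝ => r ^ a / Real.Gamma a * x ^ (a - 1) * Real.exp (-(r * x))) x :=
      (continuousAt_const.mul (Real.continuousAt_rpow_const x (a - 1) (Or.inl hx.ne'))).mul
        (by fun_prop)
    refine this.congr ?_
    filter_upwards [lt_mem_nhds hx] with y hy
    rw [gammaPDFReal, if_pos hy.le]
  have h := (intervalIntegral.integral_hasDerivAt_right (a := x) (b := x)
    (IntervalIntegrable.refl) (stronglyMeasurable_gammaPDFReal a r).stronglyMeasurableAtFilter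
    hcont).const_add (cdf (gammaMeasure a r) x)
  refine h.congr_of_eventuallyEq (Eventually.of_forall fun y => ?_)
  dsimp only
  rw [cdf_gammaMeasure_eq_integral ha hr, cdf_gammaMeasure_eq_integral ha hr,
    ← intervalIntegral.integral_Iic_sub_Iic hint.integrableOn hint.integrableOn]
  ring

theorem continuousOn_cdf_gammaMeasure {a r : ℝ} (ha : 0 < a) (hr : 0 < r) :
    ContinuousOn (cdf (gammaMeasure a r)) (Ici 0) := by
  intro x (hx : 0 ≤ x)
  rcases hx.eq_or_lt with rfl | hx
  · exact (cdf _).right_continuous 0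
  · exact (hasDerivAt_cdf_gammaMeasure ha hr hx).continuousAt.continuousWithinAt

theorem nonneg_of_hasDerivAt_of_sign {f f' : ℝ → ℝ} {a : ℝ} (hf : ContinuousOn f (Ici a))
    (hd : ∀ x, a < x → HasDerivAt f (f' x) x) (ha : 0 ≤ f a) (hlim : Tendsto f atTop (𝓝 0))
    (hsign : ∀ x y, a < y → y ≤ x → 0 ≤ f' x → 0 ≤ f' y) {x : ℝ} (hx : a ≤ x) : 0 ≤ f x := by
  rcases hx.eq_or_lt with rfl | hx
  · exact ha
  by_cases h : 0 ≤ f' x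
  · have hmono : MonotoneOn f (Icc a x) := by
      refine monotoneOn_of_deriv_nonneg (convex_Icc a x) (hf.mono Icc_subset_Ici_self) ?_ ?_
      all_goals rw [interior_Icc]; intro y hy
      · exact (hd y hy.1).differentiableAt.differentiableWithinAt
      · rw [(hd y hy.1).deriv]
        exact hsign x y hy.1 hy.2.le h
    exact ha.trans (hmono ⟨le_rfl, hx.le⟩ ⟨hx.le, le_rfl⟩ hx.le)
  · have hanti : AntitoneOn f (Ici x) := by
      refine antitoneOn_of_deriv_nonpos (convex_Ici x) (hf.mono (Ici_subset_Ici.2 hx.le)) ?_ ?_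
      all_goals rw [interior_Ici]; intro y (hy : x < y)
      · exact (hd y (hx.trans hy)).differentiableAt.differentiableWithinAt
      · rw [(hd y (hx.trans hy)).deriv]
        by_contra! hpos
        exact h (hsign y x hx hy.le hpos.le)
    refine le_of_tendsto hlim ?_
    filter_upwards [eventually_ge_atTop x] with y hy using hanti self_mem_Ici hy hy

theorem integral_exp_neg_mul_zero_one {y : ℝ} (hy : y ≠ 0) :
    ∫ t in (0 : ℝ)..1, Real.exp (-(y * t)) = (1 - Real.exp (-y)) / y := by
  simp_rw [← neg_mul]
  rw [intervalIntegral.integral_comp_mul_left (fun s => Real.exp s) (neg_ne_zero.2 hy),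
    integral_exp]
  simp only [mul_one, mul_zero, Real.exp_zero, smul_eq_mul]
  field_simp
  ring

theorem one_sub_exp_neg_div_pos {y : ℝ} (hy : 0 < y) : 0 < (1 - Real.exp (-y)) / y :=
  div_pos (sub_pos.2 (Real.exp_lt_one_iff.2 (neg_neg_of_pos hy))) hy

-- Jensen's inequality for `s ↦ s ^ (x / y)` and `s = exp (-y t)`, with `t` uniform on `[0, 1]`.
theorem one_sub_exp_neg_div_rpow_le {x y : ℝ} (hy : 0 < y) (hyx : y ≤ x) :
    ((1 - Real.exp (-y)) / y) ^ (x / y) ≤ (1 - Real.exp (-x)) / x := by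
  have hx : 0 < x := hy.trans_le hyx
  have : IsProbabilityMeasure (volume.restrict (Ioc (0 : ℝ) 1)) := ⟨by simp⟩
  have hint (z : ℝ) : Integrable (fun t => Real.exp (-(z * t))) (volume.restrict (Ioc (0 : ℝ) 1)) :=
    (Continuous.integrableOn_Icc (by fun_prop)).mono_set Ioc_subset_Icc_self
  have hcomp (t : ℝ) : Real.exp (-(y * t)) ^ (x / y) = Real.exp (-(x * t)) := by
    rw [← Real.exp_mul]
    congr 1
    field_simp
  have hjensen := (convexOn_rpow ((one_le_div hy).2 hyx)).map_integral_le
    (μ := volume.restrict (Ioc (0 : ℝ) 1)) (f := fun t => Real.exp (-(y * t)))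
    (continuousOn_id.rpow_const fun _ _ => Or.inr (div_nonneg hx.le hy.le)) isClosed_Ici
    (ae_of_all _ fun t => (Real.exp_pos _).le) (hint y)
    ((hint x).congr (ae_of_all _ fun t => (hcomp t).symm))
  simp only [hcomp] at hjensen
  rwa [← intervalIntegral.integral_of_le zero_le_one, ← intervalIntegral.integral_of_le zero_le_one,
    integral_exp_neg_mul_zero_one hy.ne', integral_exp_neg_mul_zero_one hx.ne'] at hjensen

theorem one_sub_exp_neg_div_rpow_le_exp_of_le {q κ x y : ℝ} (hq : 0 ≤ q) (hy : 0 < y) (hyx : y ≤ x)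
    (h : ((1 - Real.exp (-x)) / x) ^ q ≤ Real.exp (-(κ * x))) :
    ((1 - Real.exp (-y)) / y) ^ q ≤ Real.exp (-(κ * y)) := by
  have hpos := one_sub_exp_neg_div_pos hy
  refine (Real.rpow_le_rpow_iff (by positivity) (Real.exp_pos _).le
    (div_pos (hy.trans_le hyx) hy)).1 ?_
  calc (((1 - Real.exp (-y)) / y) ^ q) ^ (x / y)
      = (((1 - Real.exp (-y)) / y) ^ (x / y)) ^ q := by
        rw [← Real.rpow_mul hpos.le, mul_comm, Real.rpow_mul hpos.le]
    _ ≤ ((1 - Real.exp (-x)) / x) ^ q :=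
        Real.rpow_le_rpow (by positivity) (one_sub_exp_neg_div_rpow_le hy hyx) hq
    _ ≤ Real.exp (-(κ * x)) := h
    _ = Real.exp (-(κ * y)) ^ (x / y) := by
        rw [← Real.exp_mul]
        congr 1
        field_simp

section Alzer

variable {a r c : ℝ}

theorem gammaPDFReal_eq_of_rpow_eq (ha : 0 < a) (hc : 0 < c)
    (hca : c ^ a = r ^ a / Real.Gamma (a + 1)) {x : ℝ} (hx : 0 < x) :
    gammaPDFReal a r x = a * c * ((c * x) ^ (a - 1) * Real.exp (-(r * x))) := by
  have hconst : r ^ a / Real.Gamma a = a * (c ^ (a - 1) * c) := by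
    rw [← Real.rpow_add_one hc.ne', sub_add_cancel, hca, Real.Gamma_add_one ha.ne']
    have := Real.Gamma_pos_of_pos ha
    field_simp
  rw [gammaPDFReal, if_pos hx.le, hconst, Real.mul_rpow hc.le hx.le]
  ring

theorem hasDerivAt_one_sub_exp_rpow (ha : 1 ≤ a) (x : ℝ) :
    HasDerivAt (fun x => (1 - Real.exp (-(c * x))) ^ a)
      (a * c * ((1 - Real.exp (-(c * x))) ^ (a - 1) * Real.exp (-(c * x)))) x := by
  have h : HasDerivAt (fun x => 1 - Real.exp (-(c * x))) (c * Real.exp (-(c * x))) x := by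
    refine ((((hasDerivAt_id x).const_mul c).neg.exp).const_sub 1).congr_deriv ?_
    simp only [id, Pi.neg_apply]
    ring
  exact (h.rpow_const (Or.inr ha)).congr_deriv (by ring)

theorem tendsto_one_sub_exp_rpow_atTop (hc : 0 < c) :
    Tendsto (fun x => (1 - Real.exp (-(c * x))) ^ a) atTop (𝓝 1) := by
  have h := ((Real.tendsto_exp_neg_atTop_nhds_zero.comp
    (tendsto_id.const_mul_atTop hc)).const_sub 1).rpow_const (p := a) (Or.inl (by norm_num))
  simpa using h

theorem gammaPDFReal_sub_deriv_nonneg_iff (ha : 0 < a) (hc : 0 < c)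
    (hca : c ^ a = r ^ a / Real.Gamma (a + 1)) {x : ℝ} (hx : 0 < x) :
    0 ≤ gammaPDFReal a r x -
        a * c * ((1 - Real.exp (-(c * x))) ^ (a - 1) * Real.exp (-(c * x))) ↔
      ((1 - Real.exp (-(c * x))) / (c * x)) ^ (a - 1) ≤ Real.exp (-((r / c - 1) * (c * x))) := by
  have hcx : 0 < c * x := mul_pos hc hx
  have hexp : -((r / c - 1) * (c * x)) = -(r * x) - -(c * x) := by
    field_simp
    ring
  have hnum : 0 ≤ 1 - Real.exp (-(c * x)) :=
    sub_nonneg.2 (Real.exp_le_one_iff.2 (neg_nonpos.2 hcx.le))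
  rw [gammaPDFReal_eq_of_rpow_eq ha hc hca hx, ← mul_sub,
    mul_nonneg_iff_of_pos_left (mul_pos ha hc), sub_nonneg, Real.div_rpow hnum hcx.le,
    div_le_iff₀ (Real.rpow_pos_of_pos hcx _), hexp, Real.exp_sub, div_mul_eq_mul_div,
    le_div_iff₀ (Real.exp_pos _), mul_comm (Real.exp (-(r * x)))]

theorem one_sub_exp_rpow_le_cdf_gammaMeasure (ha : 1 ≤ a) (hr : 0 < r) {x : ℝ} (hx : 0 ≤ x) :
    (1 - Real.exp (-(Real.Gamma (a + 1) ^ (-(1 / a)) * r * x))) ^ a ≤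
      cdf (gammaMeasure a r) x := by
  have ha0 : 0 < a := zero_lt_one.trans_le ha
  have hΓ : 0 < Real.Gamma (a + 1) := Real.Gamma_pos_of_pos (by linarith)
  set c := Real.Gamma (a + 1) ^ (-(1 / a)) * r with hc_def
  have hc : 0 < c := by positivity
  have hca : c ^ a = r ^ a / Real.Gamma (a + 1) := by
    rw [hc_def, Real.mul_rpow (by positivity) hr.le, ← Real.rpow_mul hΓ.le, neg_mul,
      one_div_mul_cancel ha0.ne', Real.rpow_neg_one, inv_mul_eq_div]
  refine sub_nonneg.1 (nonneg_of_hasDerivAt_of_sign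
    (f := fun x => cdf (gammaMeasure a r) x - (1 - Real.exp (-(c * x))) ^ a)
    ?continuous (fun x hx => (hasDerivAt_cdf_gammaMeasure ha0 hr hx).sub
      (hasDerivAt_one_sub_exp_rpow ha x)) ?zero ?infinity ?sign hx)
  case continuous =>
    exact (continuousOn_cdf_gammaMeasure ha0 hr).sub fun x _ =>
      (hasDerivAt_one_sub_exp_rpow ha x).continuousAt.continuousWithinAt
  case zero =>
    simp [cdf_gammaMeasure_zero ha0 hr, Real.zero_rpow ha0.ne']
  case infinity =>
    have : IsProbabilityMeasure (gammaMeasure a r) := isProbabilityMeasure_gammaMeasure ha0 hr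
    simpa using (tendsto_cdf_atTop (gammaMeasure a r)).sub (tendsto_one_sub_exp_rpow_atTop hc)
  case sign =>
    intro x y hy hyx hderiv
    rw [gammaPDFReal_sub_deriv_nonneg_iff ha0 hc hca (hy.trans_le hyx)] at hderiv
    rw [gammaPDFReal_sub_deriv_nonneg_iff ha0 hc hca hy]
    exact one_sub_exp_neg_div_rpow_le_exp_of_le (sub_nonneg.2 ha) (mul_pos hc hy)
      (mul_le_mul_of_nonneg_left hyx hc.le) hderiv

end Alzer

end Gamma

section IntervalIntegral

theorem intervalIntegrable_of_measurable_of_abs_le {f : ℝ → ℝ} (hf : Measurable f) {C : ℝ}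
    (hC : ∀ x, |f x| ≤ C) (a b : ℝ) : IntervalIntegrable f volume a b :=
  intervalIntegrable_iff.2 <|
    Measure.integrableOn_of_bounded (by simp) hf.aestronglyMeasurable (ae_of_all _ hC)

theorem intervalIntegral_ite_lt {f g : ℝ → ℝ} {a m b : ℝ} (ham : a ≤ m) (hmb : m ≤ b)
    (hf : IntervalIntegrable f volume a m) (hg : IntervalIntegrable g volume m b) :
    ∫ x in a..b, (if x < m then f x else g x) = (∫ x in a..m, f x) + ∫ x in m..b, g x := by
  have hleft : Set.EqOn f (fun x => if x < m then f x else g x) (Set.Ioo a m) :=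
    fun x hx => (if_pos hx.2).symm
  have hright : Set.EqOn g (fun x => if x < m then f x else g x) (Set.Ioo m b) :=
    fun x hx => (if_neg hx.1.not_gt).symm
  rw [← intervalIntegral.integral_add_adjacent_intervals
      (hf.congr_uIoo (by rwa [Set.uIoo_of_le ham])) (hg.congr_uIoo (by rwa [Set.uIoo_of_le hmb])),
    intervalIntegral.integral_congr_Ioo_of_le ham hleft,
    intervalIntegral.integral_congr_Ioo_of_le hmb hright]

end IntervalIntegral

/-! ### The deterministic quantities of the system -/

namespace Uplink

variable {K : ℕ} (S : Uplink K) (k : Fin K)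

section Geometry

theorem RE_lt_R : S.RE < S.R k := lt_add_of_pos_left _ (S.alt_pos k)

theorem R_pos : 0 < S.R k := S.RE_pos.trans (S.RE_lt_R k)

theorem thetaMax_nonneg : 0 ≤ S.thetaMax k := by
  rw [thetaMax]
  split_ifs with h
  · have hbeam : S.beam ≤ Real.pi / 2 := h.le.trans (Real.arcsin_le_pi_div_two _)
    have hsin : 0 ≤ Real.sin S.beam :=
      Real.sin_nonneg_of_nonneg_of_le_pi S.beam_pos.le (by linarith [Real.pi_pos])
    refine sub_nonneg.2 ((Real.le_arcsin_iff_sin_le' ⟨?_, hbeam⟩).2 ?_)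
    · linarith [S.beam_pos, Real.pi_pos]
    · exact le_mul_of_one_le_left hsin ((one_le_div S.RE_pos).2 (S.RE_lt_R k).le)
  · exact Real.arccos_nonneg _

theorem thetaMax_le_pi : S.thetaMax k ≤ Real.pi := by
  rw [thetaMax]
  split_ifs
  · linarith [Real.arcsin_le_pi_div_two (S.R k / S.RE * Real.sin S.beam), S.beam_pos, Real.pi_pos]
  · exact Real.arccos_le_pi _

theorem norm_typical : ‖S.typical‖ = S.RE := by
  simp [EuclideanSpace.norm_eq, typical, Fin.sum_univ_three, Real.sqrt_sq S.RE_pos.le]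

theorem typical_ne_zero : S.typical ≠ 0 := norm_pos_iff.1 (S.norm_typical ▸ S.RE_pos)

theorem distAt_pos (θ : ℝ) : 0 < S.distAt k θ := by
  have hcos := mul_le_mul_of_nonneg_left (Real.cos_le_one θ) (mul_pos S.RE_pos (S.R_pos k)).le
  have hsq := pow_pos (sub_pos.2 (S.RE_lt_R k)) 2
  exact Real.sqrt_pos.2 (by linarith)

theorem dist_eq_distAt {x u : E3} (hx : ‖x‖ = S.R k) (hu : ‖u‖ = S.RE) :
    dist x u = S.distAt k (InnerProductGeometry.angle x u) := by
  rw [distAt, dist_eq_norm, ← Real.sqrt_sq (norm_nonneg (x - u)), sq ‖x - u‖,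
    InnerProductGeometry.norm_sub_sq_eq_norm_sq_add_norm_sq_sub_two_mul_norm_mul_norm_mul_cos_angle,
    hx, hu]
  ring_nf

theorem dist_typical_pos {x : E3} (hx : ‖x‖ = S.R k) : 0 < dist x S.typical :=
  S.dist_eq_distAt k hx S.norm_typical ▸ S.distAt_pos k _

@[fun_prop]
theorem measurable_distAt : Measurable (S.distAt k) := by
  unfold distAt
  fun_prop

end Geometry

section Power

theorem recPower_eq_mul (d h : ℝ) : S.recPower d h = S.recPower d 1 * h := by
  simp [recPower]

theorem recPower_nonneg (d : ℝ) {h : ℝ} (hh : 0 ≤ h) : 0 ≤ S.recPower d h := by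
  have := S.Pt_pos
  have := S.G_pos
  rw [recPower]
  positivity

theorem recPower_one_pos {d : ℝ} (hd : 0 < d) : 0 < S.recPower d 1 := by
  have := S.Pt_pos
  have := S.G_pos
  have := S.c_pos
  have := S.f_pos
  rw [recPower]
  positivity

@[fun_prop]
theorem measurable_recPower {α : Type*} [MeasurableSpace α] {d h : α → ℝ} (hd : Measurable d)
    (hh : Measurable h) : Measurable fun a => S.recPower (d a) (h a) := by
  unfold recPower
  fun_prop

end Power

section Fading

/-- The Laplace transform of the Gamma fading, in closed form. -/
def fadingLaplace (t : ℝ) : ℝ := (1 + S.m₂ * t) ^ (-(S.m₁ : ℤ))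

theorem integral_exp_neg_mul_gammaFading {t : ℝ} (ht : 0 ≤ t) :
    ∫ y, Real.exp (-(t * y)) ∂S.gammaFading = S.fadingLaplace t := by
  have hm₁ : (0 : ℝ) < S.m₁ := by exact_mod_cast S.m₁_pos
  have hm₂ := S.m₂_pos
  rw [gammaFading, integral_exp_neg_mul_gammaMeasure hm₁ (one_div_pos.2 hm₂) (by positivity),
    fadingLaplace, Real.rpow_natCast, zpow_neg, zpow_natCast, ← inv_pow]
  congr 1
  field_simp

theorem fadingLaplace_zero : S.fadingLaplace 0 = 1 := by simp [fadingLaplace]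

theorem fadingLaplace_nonneg {t : ℝ} (ht : 0 ≤ t) : 0 ≤ S.fadingLaplace t := by
  have := S.m₂_pos
  rw [fadingLaplace]
  positivity

theorem fadingLaplace_le_one {t : ℝ} (ht : 0 ≤ t) : S.fadingLaplace t ≤ 1 := by
  rw [fadingLaplace, zpow_neg, zpow_natCast]
  exact inv_le_one_of_one_le₀
    (one_le_pow₀ (le_add_of_nonneg_right (mul_nonneg S.m₂_pos.le ht)))

@[fun_prop]
theorem measurable_fadingLaplace : Measurable S.fadingLaplace := by
  unfold fadingLaplace
  simp_rw [zpow_neg, zpow_natCast]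
  fun_prop

theorem approxCDF_zero : S.approxCDF 0 = 0 := by
  simp [approxCDF, Nat.one_le_iff_ne_zero.1 S.m₁_pos]

theorem approxCDF_mem_Icc {t : ℝ} (ht : 0 ≤ t) : S.approxCDF t ∈ Set.Icc (0 : ℝ) 1 := by
  have := S.m₂_pos
  have hle : Real.exp (-(((S.m₁)! : ℝ) ^ (-(1 / (S.m₁ : ℝ))) / S.m₂ * t)) ≤ 1 :=
    Real.exp_le_one_iff.2 (neg_nonpos.2 (by positivity))
  have hpos := Real.exp_pos (-(((S.m₁)! : ℝ) ^ (-(1 / (S.m₁ : ℝ))) / S.m₂ * t))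
  exact ⟨pow_nonneg (by linarith) _, pow_le_one₀ (by linarith) (by linarith)⟩

@[fun_prop]
theorem continuous_approxCDF : Continuous S.approxCDF := by
  unfold approxCDF
  fun_prop

theorem approxCDF_le_cdf_gammaFading {t : ℝ} (ht : 0 ≤ t) :
    S.approxCDF t ≤ cdf S.gammaFading t := by
  have hm₁ : (1 : ℝ) ≤ S.m₁ := by exact_mod_cast S.m₁_pos
  have h := one_sub_exp_rpow_le_cdf_gammaMeasure hm₁ (one_div_pos.2 S.m₂_pos) ht
  rwa [Real.Gamma_nat_eq_factorial, mul_one_div, Real.rpow_natCast] at h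

theorem cdf_gammaFading_of_shape_one (hm₁ : S.m₁ = 1) {t : ℝ} (ht : 0 ≤ t) :
    cdf S.gammaFading t = S.approxCDF t := by
  rw [gammaFading, approxCDF, hm₁, Nat.cast_one, cdf_gammaMeasure_one (one_div_pos.2 S.m₂_pos) ht]
  simp

end Fading

section LaplaceInterference

theorem laplaceInterference_eq (s : ℝ) :
    S.laplaceInterference k s = Real.exp (-(S.dens * (2 * Real.pi * S.RE ^ 2 *
      ∫ θ in (0 : ℝ)..(S.thetaMax k),
        (1 - S.fadingLaplace (s * S.recPower (S.distAt k θ) 1)) * Real.sin θ))) := by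
  rw [laplaceInterference, intervalIntegral.integral_const, smul_eq_mul, sub_zero, neg_mul,
    mul_assoc (2 * Real.pi), ← intervalIntegral.integral_const_mul (S.RE ^ 2)]
  congr! 6
  simp only [fadingLaplace, recPower]
  ring_nf

theorem laplaceInterference_nonneg (s : ℝ) : 0 ≤ S.laplaceInterference k s :=
  (Real.exp_pos _).le

theorem laplaceInterference_le_one {s : ℝ} (hs : 0 ≤ s) : S.laplaceInterference k s ≤ 1 := by
  have hint : 0 ≤ ∫ θ in (0 : ℝ)..(S.thetaMax k),
      (1 - S.fadingLaplace (s * S.recPower (S.distAt k θ) 1)) * Real.sin θ :=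
    intervalIntegral.integral_nonneg (S.thetaMax_nonneg k) fun θ hθ => mul_nonneg
      (sub_nonneg.2 (S.fadingLaplace_le_one (mul_nonneg hs (S.recPower_nonneg _ zero_le_one))))
      (Real.sin_nonneg_of_nonneg_of_le_pi hθ.1 (hθ.2.trans (S.thetaMax_le_pi k)))
  have := S.dens_pos
  rw [laplaceInterference_eq]
  exact Real.exp_le_one_iff.2 (neg_nonpos.2 (by positivity))

@[fun_prop]
theorem measurable_laplaceInterference : Measurable (S.laplaceInterference k) := by
  have hkernel : Measurable fun p : ℝ × ℝ =>
      (1 - S.fadingLaplace (p.1 * S.recPower (S.distAt k p.2) 1)) * Real.sin p.2 := by fun_prop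
  have hint : Measurable fun s => ∫ θ in (0 : ℝ)..(S.thetaMax k),
      (1 - S.fadingLaplace (s * S.recPower (S.distAt k θ) 1)) * Real.sin θ := by
    simp_rw [intervalIntegral.integral_of_le (S.thetaMax_nonneg k)]
    exact hkernel.stronglyMeasurable.integral_prod_right'.measurable
  rw [funext (S.laplaceInterference_eq k)]
  fun_prop

end LaplaceInterference

section OutageFormula

variable {β : ℝ}

theorem sES_nonneg (hβ : 0 < β) (hβγ : β * (1 - S.γ) < S.γ) (θ : ℝ) : 0 ≤ S.sES β k θ := by
  have := S.Pt_pos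
  have := S.G_pos
  have := S.m₂_pos
  have := sub_pos.2 hβγ
  rw [sES]
  positivity

@[fun_prop]
theorem measurable_sES (β : ℝ) : Measurable (S.sES β k) := by
  unfold sES
  fun_prop

/-- The conditional outage probability of a satellite of tier `k` whose central angle with the
typical device is `θ < S.thetaMax k`, when the fading gain of the latter has distribution function
`approxCDF`. -/
def outageAt (β θ : ℝ) : ℝ :=
  ∑ q ∈ Finset.range (S.m₁ + 1), ((S.m₁.choose q : ℕ) : ℝ) * (-1) ^ q *
    (Real.exp (-(q * S.sES β k θ * S.noise)) * S.laplaceInterference k (q * S.sES β k θ))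

@[fun_prop]
theorem measurable_outageAt (β : ℝ) : Measurable (S.outageAt k β) := by
  unfold outageAt
  fun_prop

theorem outageAt_mul_sin (β θ : ℝ) :
    S.outageAt k β θ * (Real.sin θ / 2) =
      ∑ q ∈ Finset.range (S.m₁ + 1), ((S.m₁.choose q : ℕ) : ℝ) * (-1) ^ q *
        (Real.exp (-(q * S.sES β k θ * S.noise)) * S.laplaceInterference k (q * S.sES β k θ) *
          (Real.sin θ / 2)) := by
  rw [outageAt, Finset.sum_mul]
  exact Finset.sum_congr rfl fun q _ => mul_assoc _ _ _

theorem intervalIntegrable_exp_mul_laplaceInterference (hβ : 0 < β) (hβγ : β * (1 - S.γ) < S.γ)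
    (q : ℕ) (a b : ℝ) :
    IntervalIntegrable (fun θ => Real.exp (-(q * S.sES β k θ * S.noise)) *
      S.laplaceInterference k (q * S.sES β k θ) * (Real.sin θ / 2)) volume a b := by
  refine intervalIntegrable_of_measurable_of_abs_le (by fun_prop) (C := 1) (fun θ => ?_) a b
  have hs : 0 ≤ (q : ℝ) * S.sES β k θ := mul_nonneg q.cast_nonneg (S.sES_nonneg k hβ hβγ θ)
  have hexp : Real.exp (-(q * S.sES β k θ * S.noise)) ≤ 1 :=
    Real.exp_le_one_iff.2 (neg_nonpos.2 (mul_nonneg hs S.noise_pos.le))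
  have hsin : |Real.sin θ / 2| ≤ 1 := by
    rw [abs_div, abs_two]
    linarith [Real.abs_sin_le_one θ]
  have hlaplace := S.laplaceInterference_nonneg k (q * S.sES β k θ)
  rw [abs_mul, abs_mul, abs_of_nonneg (Real.exp_pos _).le, abs_of_nonneg hlaplace]
  exact mul_le_one₀ (mul_le_one₀ hexp hlaplace (S.laplaceInterference_le_one k hs))
    (abs_nonneg _) hsin

theorem intervalIntegrable_outageAt_mul_sin (hβ : 0 < β) (hβγ : β * (1 - S.γ) < S.γ) (a b : ℝ) :
    IntervalIntegrable (fun θ => S.outageAt k β θ * (Real.sin θ / 2)) volume a b := by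
  simp_rw [outageAt_mul_sin]
  simpa only [Finset.sum_fn] using IntervalIntegrable.sum (Finset.range (S.m₁ + 1)) fun q _ =>
    (S.intervalIntegrable_exp_mul_laplaceInterference k hβ hβγ q a b).const_mul
      (((S.m₁.choose q : ℕ) : ℝ) * (-1) ^ q)

theorem integral_outageAt_mul_sin (hβ : 0 < β) (hβγ : β * (1 - S.γ) < S.γ) :
    ∫ θ in (0 : ℝ)..Real.pi,
      (if θ < S.thetaMax k then S.outageAt k β θ else 1) * (Real.sin θ / 2) =
      S.tierFactor β k := by
  have hsin : ∫ θ in (S.thetaMax k)..Real.pi, Real.sin θ / 2 =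
      (1 + Real.cos (S.thetaMax k)) / 2 := by
    rw [intervalIntegral.integral_div, integral_sin, Real.cos_pi]
    ring
  simp_rw [ite_mul, one_mul]
  rw [intervalIntegral_ite_lt (S.thetaMax_nonneg k) (S.thetaMax_le_pi k)
      (S.intervalIntegrable_outageAt_mul_sin k hβ hβγ _ _)
      (Continuous.intervalIntegrable (by fun_prop) _ _), hsin, tierFactor]
  simp_rw [outageAt_mul_sin]
  rw [intervalIntegral.integral_finsetSum fun q _ =>
    (S.intervalIntegrable_exp_mul_laplaceInterference k hβ hβγ q _ _).const_mul _]
  simp_rw [intervalIntegral.integral_const_mul]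

end OutageFormula

end Uplink

section Cdf

variable {ν : Measure ℝ} [IsProbabilityMeasure ν]

theorem ae_nonneg_of_cdf_zero (hν : cdf ν 0 = 0) : ∀ᵐ t ∂ν, 0 ≤ t := by
  simp only [ae_iff, not_le]
  refine measure_mono_null Set.Iio_subset_Iic_self ?_
  rw [← ofReal_cdf ν 0, hν, ENNReal.ofReal_zero]

theorem measureReal_Iio_le_cdf (ν : Measure ℝ) [IsProbabilityMeasure ν] (t : ℝ) :
    ν.real (Set.Iio t) ≤ cdf ν t :=
  cdf_eq_real ν t ▸ measureReal_mono Set.Iio_subset_Iic_self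

theorem le_measureReal_Iio_of_le_cdf {F : ℝ → ℝ} {t : ℝ} (hF : ContinuousAt F t)
    (hle : ∀ᶠ x in nhds t, F x ≤ cdf ν x) : F t ≤ ν.real (Set.Iio t) := by
  refine le_of_tendsto (hF.tendsto.mono_left (nhdsWithin_le_nhds (s := Set.Iio t))) ?_
  filter_upwards [nhdsWithin_le_nhds hle, self_mem_nhdsWithin] with x hx hxt
  exact hx.trans (cdf_eq_real ν x ▸ measureReal_mono (Set.Iic_subset_Iio.2 hxt))

end Cdf

/-! ### One eavesdropper -/

/-- The interfering devices (their number and positions) and their fading gains. -/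
abbrev Interferers : Type := (ℕ × (ℕ → E3)) × (ℕ → ℝ)

namespace Uplink

variable {K : ℕ} (S : Uplink K) (k : Fin K)

section LinkToPosition

/-- Interference power at a satellite of tier `k` located at `x`: the value of
`EveData.interference` on a realisation of the model. -/
def interferenceAt (x : E3) (y : Interferers) : ℝ :=
  ∑ i ∈ Finset.range y.1.1,
    if InnerProductGeometry.angle x (y.1.2 i) < S.thetaMax k then
      S.recPower (dist x (y.1.2 i)) (y.2 i)
    else 0

/-- SINR at a satellite of tier `k` located at `x`, when the typical device has gain `h`: the value
of `EveData.sinr` on a realisation of the model. -/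
def sinrAt (x : E3) (h : ℝ) (y : Interferers) : ℝ :=
  if InnerProductGeometry.angle x S.typical < S.thetaMax k then
    S.γ * S.recPower (dist x S.typical) h /
      ((1 - S.γ) * S.recPower (dist x S.typical) h + S.interferenceAt k x y + S.noise)
  else 0

/-- The gain of the typical device from which on the SINR at a satellite of tier `k` located at `x`
and covering the typical device is at least `β`. -/
def gainThreshold (β : ℝ) (x : E3) (y : Interferers) : ℝ :=
  β * (S.interferenceAt k x y + S.noise) /
    ((S.γ - β * (1 - S.γ)) * S.recPower (dist x S.typical) 1)

/-- The conditional probability, given its position `x` and the interferers `y`, that a satellite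
of tier `k` has an SINR below `β`, when the gain of the typical device has distribution function
`F`. -/
def condOutage (F : ℝ → ℝ) (β : ℝ) (x : E3) (y : Interferers) : ℝ :=
  if InnerProductGeometry.angle x S.typical < S.thetaMax k then F (S.gainThreshold k β x y) else 1

/-- Power received at a satellite of tier `k` located at `x` from a device located at `u`, per unit
of fading gain; devices outside the coverage area contribute nothing. -/
def coveredPower (x u : E3) : ℝ :=
  if InnerProductGeometry.angle x u < S.thetaMax k then S.recPower (dist x u) 1 else 0

variable {α : Type*} [MeasurableSpace α] {x : α → E3} {h : α → ℝ} {y : α → Interferers}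

@[fun_prop]
theorem measurable_coveredPower {u : α → E3} (hx : Measurable x) (hu : Measurable u) :
    Measurable fun a => S.coveredPower k (x a) (u a) :=
  Measurable.ite (measurableSet_lt (by fun_prop) measurable_const) (by fun_prop) measurable_const

theorem coveredPower_nonneg (x u : E3) : 0 ≤ S.coveredPower k x u := by
  rw [coveredPower]
  split_ifs
  exacts [S.recPower_nonneg _ zero_le_one, le_rfl]

theorem interferenceAt_eq_sum (x : E3) (y : Interferers) :
    S.interferenceAt k x y =
      ∑ i ∈ Finset.range y.1.1, S.coveredPower k x (y.1.2 i) * y.2 i := by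
  simp only [interferenceAt, coveredPower, ite_mul, zero_mul, ← recPower_eq_mul]

@[fun_prop]
theorem measurable_interferenceAt (hx : Measurable x) (hy : Measurable y) :
    Measurable fun a => S.interferenceAt k (x a) (y a) := by
  simp_rw [interferenceAt_eq_sum]
  exact measurable_sum_range_count (by fun_prop) fun i => by fun_prop

@[fun_prop]
theorem measurable_gainThreshold (β : ℝ) (hx : Measurable x) (hy : Measurable y) :
    Measurable fun a => S.gainThreshold k β (x a) (y a) := by
  unfold gainThreshold
  fun_prop

theorem measurable_sinrAt (hx : Measurable x) (hh : Measurable h) (hy : Measurable y) :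
    Measurable fun a => S.sinrAt k (x a) (h a) (y a) :=
  Measurable.ite (measurableSet_lt (by fun_prop) measurable_const) (by fun_prop) measurable_const

@[fun_prop]
theorem measurable_condOutage {F : ℝ → ℝ} (hF : Measurable F) (β : ℝ) (hx : Measurable x)
    (hy : Measurable y) : Measurable fun a => S.condOutage k F β (x a) (y a) :=
  Measurable.ite (measurableSet_lt (by fun_prop) measurable_const) (by fun_prop) measurable_const

end LinkToPosition

section Realisation

variable {β : ℝ} {x : E3} {y : Interferers}

theorem interferenceAt_nonneg (x : E3) (hy : ∀ i, 0 ≤ y.2 i) : 0 ≤ S.interferenceAt k x y :=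
  S.interferenceAt_eq_sum k x y ▸
    Finset.sum_nonneg fun i _ => mul_nonneg (S.coveredPower_nonneg k x _) (hy i)

theorem gainThreshold_pos (hβ : 0 < β) (hβγ : β * (1 - S.γ) < S.γ) (hx : ‖x‖ = S.R k)
    (hy : ∀ i, 0 ≤ y.2 i) : 0 < S.gainThreshold k β x y := by
  have hpower := S.recPower_one_pos (S.dist_typical_pos k hx)
  have hinterference := S.interferenceAt_nonneg k x hy
  have := S.noise_pos
  have := sub_pos.2 hβγ
  rw [gainThreshold]
  positivity

theorem sinrAt_lt_iff (hβ : 0 < β) (hβγ : β * (1 - S.γ) < S.γ) (hx : ‖x‖ = S.R k) {h : ℝ}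
    (hh : 0 ≤ h) (hy : ∀ i, 0 ≤ y.2 i) :
    S.sinrAt k x h y < β ↔ (InnerProductGeometry.angle x S.typical < S.thetaMax k →
      h < S.gainThreshold k β x y) := by
  rw [sinrAt]
  split_ifs with hc
  · have hpower := S.recPower_one_pos (S.dist_typical_pos k hx)
    have hinterference := S.interferenceAt_nonneg k x hy
    have hartificial := mul_nonneg (sub_nonneg.2 S.γ_le_one) (mul_nonneg hpower.le hh)
    rw [recPower_eq_mul, div_lt_iff₀ (by linarith [S.noise_pos]), gainThreshold,
      lt_div_iff₀ (mul_pos (sub_pos.2 hβγ) hpower)]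
    simp only [hc, true_imp_iff]
    constructor <;> intro h <;> linarith
  · simp [hc, hβ]

theorem rate_mul_gainThreshold_eq (hβγ : β * (1 - S.γ) < S.γ) (hx : ‖x‖ = S.R k) (y : Interferers) :
    ((S.m₁)! : ℝ) ^ (-(1 / (S.m₁ : ℝ))) / S.m₂ * S.gainThreshold k β x y =
      S.sES β k (InnerProductGeometry.angle x S.typical) * (S.interferenceAt k x y + S.noise) := by
  have := S.Pt_pos
  have := S.G_pos
  have := S.m₂_pos
  have := S.c_pos
  have := S.f_pos
  have := Real.pi_pos
  have := sub_pos.2 hβγ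
  have := S.distAt_pos k (InnerProductGeometry.angle x S.typical)
  rw [gainThreshold, sES, recPower, S.dist_eq_distAt k hx S.norm_typical]
  field_simp

theorem approxCDF_gainThreshold (hβγ : β * (1 - S.γ) < S.γ) (hx : ‖x‖ = S.R k) (y : Interferers) :
    S.approxCDF (S.gainThreshold k β x y) =
      ∑ q ∈ Finset.range (S.m₁ + 1), ((S.m₁.choose q : ℕ) : ℝ) * (-1) ^ q *
        (Real.exp (-(q * S.sES β k (InnerProductGeometry.angle x S.typical) * S.noise)) *
          Real.exp (-(q * S.sES β k (InnerProductGeometry.angle x S.typical) *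
            S.interferenceAt k x y))) := by
  rw [approxCDF, S.rate_mul_gainThreshold_eq k hβγ hx, sub_eq_neg_add, add_pow]
  refine Finset.sum_congr rfl fun q _ => ?_
  rw [one_pow, mul_one, neg_pow, ← Real.exp_nat_mul, ← Real.exp_add]
  ring_nf

theorem condOutage_mem_Icc {F : ℝ → ℝ} (hF : ∀ t, 0 ≤ t → F t ∈ Set.Icc (0 : ℝ) 1)
    (hβ : 0 < β) (hβγ : β * (1 - S.γ) < S.γ) (hx : ‖x‖ = S.R k) (hy : ∀ i, 0 ≤ y.2 i) :
    S.condOutage k F β x y ∈ Set.Icc (0 : ℝ) 1 := by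
  rw [condOutage]
  split_ifs
  · exact hF _ (S.gainThreshold_pos k hβ hβγ hx hy).le
  · exact ⟨zero_le_one, le_rfl⟩

theorem integral_one_sub_fadingLaplace_coveredPower (hx : ‖x‖ = S.R k) {s : ℝ} (hs : 0 ≤ s) :
    ∫ u, (1 - S.fadingLaplace (s * S.coveredPower k x u)) ∂sphereArea S.RE =
      2 * Real.pi * S.RE ^ 2 * ∫ θ in (0 : ℝ)..(S.thetaMax k),
        (1 - S.fadingLaplace (s * S.recPower (S.distAt k θ) 1)) * Real.sin θ := by
  have hx0 : x ≠ 0 := norm_pos_iff.1 (hx ▸ S.R_pos k)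
  let g : ℝ → ℝ := fun θ => if θ < S.thetaMax k then
    1 - S.fadingLaplace (s * S.recPower (S.distAt k θ) 1) else 0
  have hg : Measurable g :=
    Measurable.ite (measurableSet_lt measurable_id measurable_const) (by fun_prop) measurable_const
  have hangle : (fun u => 1 - S.fadingLaplace (s * S.coveredPower k x u)) =ᵐ[sphereArea S.RE]
      fun u => g (InnerProductGeometry.angle x u) := by
    filter_upwards [ae_norm_sphereArea S.RE_pos.le] with u hu
    simp only [coveredPower, g]
    split_ifs
    · rw [S.dist_eq_distAt k hx hu]
    · rw [mul_zero, fadingLaplace_zero, sub_self]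
  have hint : IntervalIntegrable (fun θ => (1 - S.fadingLaplace (s * S.recPower (S.distAt k θ) 1)) *
      Real.sin θ) volume 0 (S.thetaMax k) := by
    refine intervalIntegrable_of_measurable_of_abs_le (by fun_prop) (C := 1) (fun θ => ?_) _ _
    have ht : 0 ≤ s * S.recPower (S.distAt k θ) 1 :=
      mul_nonneg hs (S.recPower_nonneg _ zero_le_one)
    rw [abs_mul, abs_of_nonneg (sub_nonneg.2 (S.fadingLaplace_le_one ht))]
    exact mul_le_one₀ (sub_le_self _ (S.fadingLaplace_nonneg ht)) (abs_nonneg _)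
      (Real.abs_sin_le_one θ)
  rw [integral_congr_ae hangle, integral_comp_angle_sphereArea hx0 S.RE_pos hg]
  simp only [g, ite_mul, zero_mul]
  rw [intervalIntegral_ite_lt (S.thetaMax_nonneg k) (S.thetaMax_le_pi k) hint
    intervalIntegrable_const, intervalIntegral.integral_zero, add_zero]

end Realisation

end Uplink

namespace EveData

variable {Ω : Type*} {K : ℕ}

/-- The interfering devices and their fading gains, as seen by one eavesdropper: the part of
`EveData.all` that enters the interference. -/
def interferers (D : EveData Ω) (ω : Ω) : Interferers := (D.all ω).2.2

theorem sinr_eq_sinrAt (D : EveData Ω) (S : Uplink K) (k : Fin K) (ω : Ω) :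
    D.sinr S k ω = S.sinrAt k (D.pos ω) (D.gain ω) (D.interferers ω) := rfl

namespace HasModelLaw

variable [MeasurableSpace Ω] {P : Measure Ω} {D : EveData Ω}
  {S : Uplink K} {k : Fin K} {ν : Measure ℝ} {β : ℝ}

section ModelLaw

theorem measurable_interferers (h : D.HasModelLaw S k ν P) : Measurable D.interferers :=
  (h.devices.measurable_count.prodMk (measurable_pi_lambda _ h.devices.measurable_point)).prodMk
    (measurable_pi_lambda _ h.measurable_devGain)

theorem isProbabilityMeasure_gain [IsProbabilityMeasure P] (h : D.HasModelLaw S k ν P) :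
    IsProbabilityMeasure ν :=
  h.gain_law ▸ Measure.isProbabilityMeasure_map h.measurable_gain.aemeasurable

theorem indepFun_pos_interferers (h : D.HasModelLaw S k ν P) : IndepFun D.pos D.interferers P :=
  h.indep_pos.comp measurable_id measurable_snd

theorem indepFun_pos_interferers_gain [IsProbabilityMeasure P] (h : D.HasModelLaw S k ν P) :
    IndepFun (fun ω => (D.pos ω, D.interferers ω)) D.gain P :=
  (indepFun_prodMk_rotate h.measurable_pos h.measurable_gain h.measurable_interferers
    h.indep_pos h.indep_gain).symm

theorem ae_norm_pos (h : D.HasModelLaw S k ν P) : ∀ᵐ ω ∂P, ‖D.pos ω‖ = S.R k := by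
  have hnorm : ∀ᵐ x ∂P.map D.pos, ‖x‖ = S.R k :=
    h.pos_law ▸ Measure.ae_smul_measure (ae_norm_sphereArea (S.R_pos k).le) _
  exact ae_of_ae_map h.measurable_pos.aemeasurable hnorm

theorem ae_devGain_nonneg (h : D.HasModelLaw S k ν P) :
    ∀ᵐ ω ∂P, ∀ i, 0 ≤ (D.interferers ω).2 i := by
  refine ae_all_iff.2 fun i => ae_of_ae_map (h.measurable_devGain i).aemeasurable ?_
  rw [h.devGain_law i]
  exact ae_nonneg_gammaMeasure _ _

theorem ae_gain_nonneg (h : D.HasModelLaw S k ν P) (hν : ∀ᵐ t ∂ν, 0 ≤ t) :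
    ∀ᵐ ω ∂P, 0 ≤ D.gain ω :=
  ae_of_ae_map h.measurable_gain.aemeasurable (h.gain_law ▸ hν)

end ModelLaw

section Interference

theorem integral_exp_neg_interferenceAt [IsProbabilityMeasure P] (h : D.HasModelLaw S k ν P)
    {x : E3} (hx : ‖x‖ = S.R k) {s : ℝ} (hs : 0 ≤ s) :
    ∫ ω, Real.exp (-(s * S.interferenceAt k x (D.interferers ω))) ∂P =
      S.laplaceInterference k s := by
  have hpower : ∀ u, 0 ≤ s * S.coveredPower k x u :=
    fun u => mul_nonneg hs (S.coveredPower_nonneg k x u)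
  have hsum (ω : Ω) : s * S.interferenceAt k x (D.interferers ω) =
      ∑ i ∈ Finset.range (D.n ω), s * S.coveredPower k x (D.dev i ω) * D.devGain i ω := by
    simp_rw [mul_assoc s, ← Finset.mul_sum]
    rw [Uplink.interferenceAt_eq_sum]
    rfl
  have hmarks : ∀ᵐ y ∂S.gammaFading, 0 ≤ y := ae_nonneg_gammaMeasure _ _
  simp_rw [hsum]
  rw [h.devices.integral_exp_neg_sum_mul_mark h.measurable_devGain h.devGain_law hmarks
    h.devGain_indep h.indep_devices (f := fun u => s * S.coveredPower k x u) (by fun_prop) hpower]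
  simp_rw [fun u => S.integral_exp_neg_mul_gammaFading (hpower u)]
  rw [integral_smul_measure, ENNReal.toReal_ofReal S.dens_pos.le, smul_eq_mul,
    S.integral_one_sub_fadingLaplace_coveredPower k hx hs, S.laplaceInterference_eq]

theorem integral_approxCDF_gainThreshold [IsProbabilityMeasure P] (h : D.HasModelLaw S k ν P)
    (hβ : 0 < β) (hβγ : β * (1 - S.γ) < S.γ) {x : E3} (hx : ‖x‖ = S.R k) :
    ∫ ω, S.approxCDF (S.gainThreshold k β x (D.interferers ω)) ∂P =
      S.outageAt k β (InnerProductGeometry.angle x S.typical) := by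
  have hs (q : ℕ) : 0 ≤ q * S.sES β k (InnerProductGeometry.angle x S.typical) :=
    mul_nonneg q.cast_nonneg (S.sES_nonneg k hβ hβγ _)
  have hint (q : ℕ) : Integrable (fun ω => Real.exp (-(q * S.sES β k
      (InnerProductGeometry.angle x S.typical) * S.interferenceAt k x (D.interferers ω)))) P := by
    have := h.measurable_interferers
    refine Integrable.of_bound (Measurable.aestronglyMeasurable (by fun_prop)) 1 ?_
    filter_upwards [h.ae_devGain_nonneg] with ω hω
    rw [Real.norm_of_nonneg (Real.exp_pos _).le, Real.exp_le_one_iff, neg_nonpos]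
    exact mul_nonneg (hs q) (S.interferenceAt_nonneg k x hω)
  simp_rw [S.approxCDF_gainThreshold k hβγ hx]
  rw [integral_finsetSum _ fun q _ => ((hint q).const_mul _).const_mul _, Uplink.outageAt]
  refine Finset.sum_congr rfl fun q _ => ?_
  rw [integral_const_mul, integral_const_mul, h.integral_exp_neg_interferenceAt hx (hs q)]

end Interference

section CondOutage

theorem integrable_condOutage [IsProbabilityMeasure P] (h : D.HasModelLaw S k ν P) (hβ : 0 < β)
    (hβγ : β * (1 - S.γ) < S.γ) {F : ℝ → ℝ} (hF : Measurable F)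
    (hF01 : ∀ t, 0 ≤ t → F t ∈ Set.Icc (0 : ℝ) 1) :
    Integrable (fun ω => S.condOutage k F β (D.pos ω) (D.interferers ω)) P := by
  have := h.measurable_pos
  have := h.measurable_interferers
  refine Integrable.of_bound (Measurable.aestronglyMeasurable (by fun_prop)) 1 ?_
  filter_upwards [h.ae_norm_pos, h.ae_devGain_nonneg] with ω hpos hgain
  have hmem := S.condOutage_mem_Icc k hF01 hβ hβγ hpos hgain
  exact (Real.norm_of_nonneg hmem.1).trans_le hmem.2

theorem integral_condOutage_approxCDF [IsProbabilityMeasure P] (h : D.HasModelLaw S k ν P)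
    (hβ : 0 < β) (hβγ : β * (1 - S.γ) < S.γ) :
    ∫ ω, S.condOutage k S.approxCDF β (D.pos ω) (D.interferers ω) ∂P = S.tierFactor β k := by
  let g : ℝ → ℝ := fun θ => if θ < S.thetaMax k then S.outageAt k β θ else 1
  have hg : Measurable g :=
    Measurable.ite (measurableSet_lt measurable_id measurable_const) (by fun_prop) measurable_const
  have happrox : Measurable S.approxCDF := S.continuous_approxCDF.measurable
  have hinner : (fun ω => ∫ ω', S.condOutage k S.approxCDF β (D.pos ω) (D.interferers ω') ∂P) =ᵐ[P]
      fun ω => g (InnerProductGeometry.angle S.typical (D.pos ω)) := by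
    filter_upwards [h.ae_norm_pos] with ω hω
    rw [InnerProductGeometry.angle_comm]
    simp only [Uplink.condOutage, g]
    split_ifs
    · exact h.integral_approxCDF_gainThreshold hβ hβγ hω
    · simp
  calc ∫ ω, S.condOutage k S.approxCDF β (D.pos ω) (D.interferers ω) ∂P
      = ∫ ω, ∫ ω', S.condOutage k S.approxCDF β (D.pos ω) (D.interferers ω') ∂P ∂P :=
        integral_comp_prodMk_of_indepFun
          (F := fun p : E3 × Interferers => S.condOutage k S.approxCDF β p.1 p.2)
          h.measurable_pos h.measurable_interferers h.indepFun_pos_interferers (by fun_prop)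
          (h.integrable_condOutage hβ hβγ happrox fun _ => S.approxCDF_mem_Icc)
    _ = ∫ ω, g (InnerProductGeometry.angle S.typical (D.pos ω)) ∂P := integral_congr_ae hinner
    _ = ∫ x, g (InnerProductGeometry.angle S.typical x) ∂uniformSphere (S.R k) := by
        rw [← h.pos_law]
        exact (integral_map h.measurable_pos.aemeasurable
          (hg.comp (by fun_prop)).aestronglyMeasurable).symm
    _ = S.tierFactor β k := by
        rw [integral_comp_angle_uniformSphere S.typical_ne_zero (S.R_pos k) hg,
          S.integral_outageAt_mul_sin k hβ hβγ]

theorem measureReal_sinr_lt [IsProbabilityMeasure P] (h : D.HasModelLaw S k ν P) (hβ : 0 < β)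
    (hβγ : β * (1 - S.γ) < S.γ) (hν : ∀ᵐ t ∂ν, 0 ≤ t) :
    P.real {ω | D.sinr S k ω < β} =
      ∫ ω, S.condOutage k (fun t => ν.real (Set.Iio t)) β (D.pos ω) (D.interferers ω) ∂P := by
  let B : Set ((E3 × Interferers) × ℝ) := {p | InnerProductGeometry.angle p.1.1 S.typical <
    S.thetaMax k → p.2 < S.gainThreshold k β p.1.1 p.1.2}
  have hB : MeasurableSet B := by
    have hcov : MeasurableSet {p : (E3 × Interferers) × ℝ |
        InnerProductGeometry.angle p.1.1 S.typical < S.thetaMax k} :=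
      measurableSet_lt (by fun_prop) measurable_const
    exact hcov.imp (measurableSet_lt measurable_snd (by fun_prop))
  have hset : ∀ᵐ ω ∂P, ω ∈ {ω | D.sinr S k ω < β} ↔
      ω ∈ {ω | ((D.pos ω, D.interferers ω), D.gain ω) ∈ B} := by
    filter_upwards [h.ae_norm_pos, h.ae_gain_nonneg hν, h.ae_devGain_nonneg] with ω hpos hgain hdev
    simpa only [Set.mem_ofPred_eq, sinr_eq_sinrAt, B] using
      S.sinrAt_lt_iff k hβ hβγ hpos hgain hdev
  rw [measureReal_congr (Filter.eventuallyEq_set.2 hset), measureReal_prodMk_mem_of_indepFun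
    (h.measurable_pos.prodMk h.measurable_interferers) h.measurable_gain
    h.indepFun_pos_interferers_gain hB]
  congr 1 with ω
  rw [Uplink.condOutage]
  split_ifs with hc
  · rw [← h.gain_law, map_measureReal_apply h.measurable_gain measurableSet_Iio]
    simp only [B, Set.mem_ofPred_eq, hc, true_imp_iff]
    rfl
  · simp [B, hc]

end CondOutage

section Outage

theorem tierFactor_nonneg [IsProbabilityMeasure P] (h : D.HasModelLaw S k ν P)
    (hβ : 0 < β) (hβγ : β * (1 - S.γ) < S.γ) : 0 ≤ S.tierFactor β k := by
  rw [← h.integral_condOutage_approxCDF hβ hβγ]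
  refine integral_nonneg_of_ae ?_
  filter_upwards [h.ae_norm_pos, h.ae_devGain_nonneg] with ω hpos hdev
  exact (S.condOutage_mem_Icc k (fun _ => S.approxCDF_mem_Icc) hβ hβγ hpos hdev).1

theorem measureReal_sinr_lt_eq_tierFactor [IsProbabilityMeasure P] (h : D.HasModelLaw S k ν P)
    (hβ : 0 < β) (hβγ : β * (1 - S.γ) < S.γ) (hν : ∀ x, 0 ≤ x → cdf ν x = S.approxCDF x) :
    P.real {ω | D.sinr S k ω < β} = S.tierFactor β k := by
  have := h.isProbabilityMeasure_gain
  have hν0 : ∀ᵐ t ∂ν, 0 ≤ t :=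
    ae_nonneg_of_cdf_zero ((hν 0 le_rfl).trans S.approxCDF_zero)
  rw [h.measureReal_sinr_lt hβ hβγ hν0, ← h.integral_condOutage_approxCDF hβ hβγ]
  refine integral_congr_ae ?_
  filter_upwards [h.ae_norm_pos, h.ae_devGain_nonneg] with ω hpos hdev
  have ht := S.gainThreshold_pos k hβ hβγ hpos hdev
  have heq : ν.real (Set.Iio (S.gainThreshold k β (D.pos ω) (D.interferers ω))) =
      S.approxCDF (S.gainThreshold k β (D.pos ω) (D.interferers ω)) :=
    ((measureReal_Iio_le_cdf ν _).trans_eq (hν _ ht.le)).antisymm <|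
      le_measureReal_Iio_of_le_cdf S.continuous_approxCDF.continuousAt
        ((lt_mem_nhds ht).mono fun x hx => (hν x hx.le).ge)
  simp only [Uplink.condOutage, heq]

theorem tierFactor_le_measureReal_sinr_lt [IsProbabilityMeasure P] (h : D.HasModelLaw S k ν P)
    (hβ : 0 < β) (hβγ : β * (1 - S.γ) < S.γ) (hν0 : ∀ᵐ t ∂ν, 0 ≤ t)
    (hν : ∀ x, 0 ≤ x → S.approxCDF x ≤ cdf ν x) :
    S.tierFactor β k ≤ P.real {ω | D.sinr S k ω < β} := by
  have := h.isProbabilityMeasure_gain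
  have hmono : Monotone fun t => ν.real (Set.Iio t) :=
    fun a b hab => measureReal_mono (Set.Iio_subset_Iio hab)
  rw [h.measureReal_sinr_lt hβ hβγ hν0, ← h.integral_condOutage_approxCDF hβ hβγ]
  refine integral_mono_ae
    (h.integrable_condOutage hβ hβγ S.continuous_approxCDF.measurable
      fun _ => S.approxCDF_mem_Icc)
    (h.integrable_condOutage hβ hβγ hmono.measurable
      fun _ _ => ⟨measureReal_nonneg, measureReal_le_one⟩) ?_
  filter_upwards [h.ae_norm_pos, h.ae_devGain_nonneg] with ω hpos hdev
  rw [Uplink.condOutage, Uplink.condOutage]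
  split_ifs
  · exact le_measureReal_Iio_of_le_cdf S.continuous_approxCDF.continuousAt
      ((lt_mem_nhds (S.gainThreshold_pos k hβ hβγ hpos hdev)).mono fun x hx => hν x hx.le)
  · exact le_rfl

end Outage

end HasModelLaw

end EveData

/-! ### All eavesdroppers -/

namespace Uplink

variable {Ω : Type*} {K : ℕ} (S : Uplink K)

theorem maxSINR_lt_iff (D : S.Eve → EveData Ω) (β : ℝ) (ω : Ω) :
    S.maxSINR D ω < (β : EReal) ↔ ∀ e, (D e).sinr S (S.tier e) ω < β := by
  rw [maxSINR, Finset.sup_lt_iff (EReal.bot_lt_coe β)]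
  simp

theorem prod_eve_comp_tier (w : Fin K → ℝ) :
    ∏ e : S.Eve, w (S.tier e) = ∏ k ∈ Finset.univ.erase S.legit, w k ^ S.num k := by
  rw [Fintype.prod_sigma,
    Finset.prod_subtype (p := fun k => k ≠ S.legit) (F := inferInstance) _ (by simp)]
  simp [tier]

variable [MeasurableSpace Ω] {P : Measure Ω} {D : S.Eve → EveData Ω} {β : ℝ}

theorem outageProb_eq_prod (hind : S.EavesdroppersIndep P D) (β : ℝ) :
    S.outageProb P D β = ∏ e, P.real {ω | (D e).sinr S (S.tier e) ω < β} := by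
  let A (e : S.Eve) : Set (E3 × ℝ × Interferers) :=
    {p | S.sinrAt (S.tier e) p.1 p.2.1 p.2.2 < β}
  have hA (e : S.Eve) : MeasurableSet (A e) :=
    measurableSet_lt (S.measurable_sinrAt _ measurable_fst measurable_snd.fst measurable_snd.snd)
      measurable_const
  have hset : {ω | S.maxSINR D ω < (β : EReal)} = ⋂ e ∈ Finset.univ, (D e).all ⁻¹' A e := by
    ext ω
    simp only [Set.mem_ofPred_eq, S.maxSINR_lt_iff, Finset.mem_univ, Set.iInter_true,
      Set.mem_iInter, Set.mem_preimage]
    rfl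
  rw [outageProb, measureReal_def, hset,
    hind.measure_inter_preimage_eq_mul Finset.univ fun e _ => hA e, ENNReal.toReal_prod]
  rfl

theorem outageProb_eq_outageFormula (hind : S.EavesdroppersIndep P D)
    (h : ∀ e, P.real {ω | (D e).sinr S (S.tier e) ω < β} = S.tierFactor β (S.tier e)) :
    S.outageProb P D β = S.outageFormula β := by
  rw [S.outageProb_eq_prod hind, outageFormula, ← S.prod_eve_comp_tier (S.tierFactor β)]
  exact Finset.prod_congr rfl fun e _ => h e

theorem outageFormula_le_outageProb (hind : S.EavesdroppersIndep P D)
    (h0 : ∀ e, 0 ≤ S.tierFactor β (S.tier e))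
    (h : ∀ e, S.tierFactor β (S.tier e) ≤ P.real {ω | (D e).sinr S (S.tier e) ω < β}) :
    S.outageFormula β ≤ S.outageProb P D β := by
  rw [S.outageProb_eq_prod hind, outageFormula, ← S.prod_eve_comp_tier (S.tierFactor β)]
  exact Finset.prod_le_prod (fun e _ => h0 e) fun e _ => h e

end Uplink

end

theorem theorem1 {Ω : Type*} [MeasurableSpace Ω] (P : Measure Ω) [IsProbabilityMeasure P]
    {K : ℕ} (S : Uplink K) (β : ℝ) (hβ : 0 < β) (hβγ : β * (1 - S.γ) < S.γ)
    (ν : Measure ℝ) (D : S.Eve → EveData Ω)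
    (hD : ∀ e, (D e).HasModelLaw S (S.tier e) ν P) :
    -- the typical device's gain has the approximating distribution function
    ((∀ x : ℝ, 0 ≤ x → cdf ν x = S.approxCDF x) →
      (∀ e, P.real {ω | (D e).sinr S (S.tier e) ω < β} = S.tierFactor β (S.tier e)) ∧
      (S.EavesdroppersIndep P D → S.outageProb P D β = S.outageFormula β)) ∧
    -- the typical device's gain is Gamma distributed
    (ν = S.gammaFading →
      (∀ e, S.tierFactor β (S.tier e) ≤ P.real {ω | (D e).sinr S (S.tier e) ω < β}) ∧
      (S.EavesdroppersIndep P D → S.outageFormula β ≤ S.outageProb P D β) ∧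
      (S.m₁ = 1 →
        (∀ e, P.real {ω | (D e).sinr S (S.tier e) ω < β} = S.tierFactor β (S.tier e)) ∧
        (S.EavesdroppersIndep P D → S.outageProb P D β = S.outageFormula β))) := by
  have heq (hν : ∀ x : ℝ, 0 ≤ x → cdf ν x = S.approxCDF x) (e : S.Eve) :
      P.real {ω | (D e).sinr S (S.tier e) ω < β} = S.tierFactor β (S.tier e) :=
    (hD e).measureReal_sinr_lt_eq_tierFactor hβ hβγ hν
  refine ⟨fun hν => ⟨heq hν, fun hind => S.outageProb_eq_outageFormula hind (heq hν)⟩, ?_⟩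
  rintro rfl
  have hle (e : S.Eve) :
      S.tierFactor β (S.tier e) ≤ P.real {ω | (D e).sinr S (S.tier e) ω < β} :=
    (hD e).tierFactor_le_measureReal_sinr_lt hβ hβγ (ae_nonneg_gammaMeasure _ _)
      fun _ => S.approxCDF_le_cdf_gammaFading
  refine ⟨hle, fun hind => ?_, fun hm₁ => ?_⟩
  · exact S.outageFormula_le_outageProb hind (fun e => (hD e).tierFactor_nonneg hβ hβγ) hle
  · have hexact := heq fun _ => S.cdf_gammaFading_of_shape_one hm₁
    exact ⟨hexact, fun hind => S.outageProb_eq_outageFormula hind hexact⟩
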